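/- Let $E$ and $F$ be row-finite directed graphs with no sources (every vertex receives at least one and only finitely many edges; paths $x=x_1x_2\cdots$ satisfy $s(x_i)=r(x_{i+1})$), and let $R$ be an integral domain with identity, equipped with an involution $r\mapsto\overline r$ (a ring automorphism of order at most two). Let $E^\infty$ be the infinite-path space, with the topology generated by the cylinder sets $Z(\mu)=\{\mu z\}$, and let $G_E=\{(x,k,y): \sigma^a(x)=\sigma^b(y),\ a-b=k \text{ for some } a,b\in\mathbb N\}$ be the graph groupoid, with units $(x,0,x)$ identified with $x\in E^\infty$. Regard the Leavitt path algebra $L_R(E)$ as the Steinberg algebra of $G_E$: the $R$-span of the characteristic functions $1_{Z(\mu,\nu)}$ of the sets $Z(\mu,\nu)=\{(\mu z,|\mu|-|\nu|,\nu z)\}$, with convolution $(f*g)(\gamma)=\sum_{r(\eta)=r(\gamma)}f(\eta)g(\eta^{-1}\gamma)$ and involution $f^*(\gamma)=\overline{f(\gamma^{-1})}$. Let $D(E)$ be the span of the elements $1_{Z(\mu)}=1_{Z(\mu,\mu)}$ (the diagonal) and $N(E)=\{n\in L_R(E): nD(E)n^*\cup n^*D(E)n\subset D(E)\}$ (the normalizers).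 For $n\in N(E)$ put $\operatorname{dom}(n)=\operatorname{supp}(n^*n)\subset E^\infty$, and for $x\in\operatorname{dom}(n)$ let $\alpha_n(x)$ be the unique element of $r(\operatorname{supp}(n)x)$. The algebraic Weyl groupoid $W_E$ is the set of classes $[(n,x)]$, $n\in N(E)$, $x\in\operatorname{dom}(n)$, for the equivalence relation in which $(n,x)\sim(m,x')$ if and only if $x=x'$ and either $x$ is isolated in $E^\infty$, $\alpha_n(x)=\alpha_m(x)$ and $1_{\{x\}}n^*m1_{\{x\}}$ is homogeneous of degree $0$ (supported on elements $(y,0,z)$ of $G_E$), or $x$ is not isolated and $\alpha_n,\alpha_m$ agree on an open neighbourhood $V\subset\operatorname{dom}(n)\cap\operatorname{dom}(m)$ of $x$. Its product is $[(n_1,x_1)][(n_2,x_2)]=[(n_1n_2,x_2)]$, defined when $\alpha_{n_2}(x_2)=x_1$; range, source and inverse are $r([(n,x)])=[(nn^*,\alpha_n(x))]$, $s([(n,x)])=[(n^*n,x)]$, $[(n,x)]^{-1}=[(n^*,\alpha_n(x))]$; its topology is generated by the sets $Z(n)=\{[(n,x)]:x\in\operatorname{dom}(n)\}$, $n\in N(E)$.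 **Proposition.** Let $\pi:L_R(E)\to L_R(F)$ be a ring $*$-isomorphism (not necessarily $R$-linear) with $\pi(D(E))=D(F)$. Then there is a homeomorphism $\kappa:E^\infty\to F^\infty$ such that for every compact open $L\subset E^\infty$ and every $x\in E^\infty$, $$x\in L\iff \kappa(x)\in\operatorname{supp}(\pi(1_L)),$$ and $\kappa$ is the only map with this property. Moreover $\pi(n)\in N(F)$ for all $n\in N(E)$ and $\kappa(x)\in\operatorname{dom}(\pi(n))$ for all $x\in\operatorname{dom}(n)$, and $$\Psi([(n,x)])=[(\pi(n),\kappa(x))]$$ is a well-defined isomorphism of topological groupoids $W_E\to W_F$, that is, a homeomorphism that respects range, source and the partially defined product. -/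

import Mathlib

set_option linter.checkUnivs false
set_option linter.unusedSectionVars false

universe u v w u₁ v₁ u₂ v₂

/-- A directed graph `(E⁰, E¹, r, s)`. -/
structure DirectedGraph where
  Vertex : Type u
  Edge : Type v
  r : Edge → Vertex
  s : Edge → Vertex

namespace DirectedGraph

/-- Every vertex receives only finitely many edges. -/
def RowFinite (E : DirectedGraph.{u, v}) : Prop := ∀ v : E.Vertex, {e : E.Edge | E.r e = v}.Finite

/-- Every vertex receives at least one edge. -/
def NoSources (E : DirectedGraph.{u, v}) : Prop := ∀ v : E.Vertex, ∃ e : E.Edge, E.r e = v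

/-- A finite path `μ = μ₀ μ₁ ⋯` with `s(μᵢ) = r(μᵢ₊₁)`, including its range vertex `r(μ)`; the paths
of length `0` are the vertices. -/
structure FinPath (E : DirectedGraph.{u, v}) where
  range : E.Vertex
  length : ℕ
  edge : Fin length → E.Edge
  range_eq : ∀ h : 0 < length, E.r (edge ⟨0, h⟩) = range
  chain : ∀ (i : ℕ) (h : i + 1 < length),
    E.s (edge ⟨i, Nat.lt_of_succ_lt h⟩) = E.r (edge ⟨i + 1, h⟩)

/-- An infinite path `x = x₀ x₁ x₂ ⋯` with `s(xᵢ) = r(xᵢ₊₁)`. -/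
@[ext] structure InfPath (E : DirectedGraph.{u, v}) where
  edge : ℕ → E.Edge
  chain : ∀ i : ℕ, E.s (edge i) = E.r (edge (i + 1))

variable {E : DirectedGraph.{u, v}}

/-- The range of an infinite path. -/
def InfPath.range (x : InfPath E) : E.Vertex := E.r (x.edge 0)

/-- The initial segment `x(0, n)` of an infinite path. -/
def InfPath.take (x : InfPath E) (n : ℕ) : FinPath E where
  range := x.range
  length := n
  edge i := x.edge i
  range_eq _ := rfl
  chain i _ := x.chain i

/-- The cylinder set `Z(μ)`: the infinite paths that begin with `μ`. -/
def FinPath.cylinder (μ : FinPath E) : Set (InfPath E) :=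
  {x | x.range = μ.range ∧ ∀ i : Fin μ.length, x.edge i = μ.edge i}

/-- The topology of the infinite-path space, generated by the cylinder sets. -/
instance InfPath.instTopologicalSpace : TopologicalSpace (InfPath E) :=
  TopologicalSpace.generateFrom (Set.range (FinPath.cylinder (E := E)))

/-- The graph groupoid `G_E`: triples `(x, k, y)` of infinite paths `x`, `y` and an integer `k` such
that `x` and `y` are shift equivalent with lag `k`, that is, `σᵃ(x) = σᵇ(y)` for some natural
numbers `a`, `b` with `a - b = k`. The range is `x` and the source is `y`. -/
@[ext] structure GraphGroupoid (E : DirectedGraph.{u, v}) where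
  range : InfPath E
  lag : ℤ
  source : InfPath E
  shift : ∃ a b : ℕ, lag = (a : ℤ) - b ∧ ∀ i : ℕ, range.edge (a + i) = source.edge (b + i)

namespace GraphGroupoid

/-- The identity morphism `(x, 0, x)`. -/
def unit (x : InfPath E) : GraphGroupoid E where
  range := x
  lag := 0
  source := x
  shift := ⟨0, 0, by simp, fun _ => rfl⟩

/-- The inverse `(x, k, y)⁻¹ = (y, -k, x)`. -/
def inv (g : GraphGroupoid E) : GraphGroupoid E where
  range := g.source
  lag := -g.lag
  source := g.range
  shift := by
    obtain ⟨a, b, h, h'⟩ := g.shift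
    exact ⟨b, a, by omega, fun i => (h' i).symm⟩

/-- The composition `(x, k, y)(y, l, z) = (x, k + l, z)`. -/
def comp (g h : GraphGroupoid E) (hgh : g.source = h.range) : GraphGroupoid E where
  range := g.range
  lag := g.lag + h.lag
  source := h.source
  shift := by
    obtain ⟨a, b, hl, h1⟩ := g.shift
    obtain ⟨c, d, hl', h2⟩ := h.shift
    refine ⟨a + c, b + d, by push_cast; omega, fun i => ?_⟩
    rw [show a + c + i = a + (c + i) by omega, h1, hgh, show b + (c + i) = c + (b + i) by omega, h2]
    congr 1
    omega

/-- The basic set `Z(μ, ν) = {(μz, |μ| - |ν|, νz)}`: here `x = μz` and `y = νz` is written as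
`x ∈ Z(μ)`, `y ∈ Z(ν)` and equality of the remaining parts of `x` and `y`. It is empty if
`s(μ) ≠ s(ν)`. -/
def Z (μ ν : FinPath E) : Set (GraphGroupoid E) :=
  {g | g.range ∈ μ.cylinder ∧ g.source ∈ ν.cylinder ∧ g.lag = (μ.length : ℤ) - ν.length ∧
    ∀ i : ℕ, g.range.edge (μ.length + i) = g.source.edge (ν.length + i)}

end GraphGroupoid

open GraphGroupoid

variable {R : Type w} [CommRing R]

/-- The characteristic function of a subset of the groupoid. -/
noncomputable def charFun (R : Type w) [CommRing R] (A : Set (GraphGroupoid E)) :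
    GraphGroupoid E → R := A.indicator fun _ => 1

/-- The convolution `(f * g)(γ) = ∑_{r(η) = r(γ)} f(η) g(η⁻¹γ)`. -/
noncomputable def conv (f g : GraphGroupoid E → R) : GraphGroupoid E → R := fun γ =>
  ∑ᶠ η : {η : GraphGroupoid E // η.range = γ.range}, f η.1 * g (η.1.inv.comp γ η.2)

/-- The involution `f*(γ) = conj f(γ⁻¹)`. -/
def convStar [StarRing R] (f : GraphGroupoid E → R) : GraphGroupoid E → R := fun γ => star (f γ.inv)

/-- The Leavitt path algebra `L_R(E)` in its groupoid model: the Steinberg algebra of `G_E`, the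
`R`-linear span of the characteristic functions of the sets `Z(μ, ν)`, with convolution product. -/
noncomputable def LPA (R : Type w) [CommRing R] (E : DirectedGraph.{u, v}) :
    Submodule R (GraphGroupoid E → R) :=
  Submodule.span R (Set.range fun p : FinPath E × FinPath E => charFun R (Z p.1 p.2))

/-! ### The ring structure -/

section aux

lemma InfPath.mem_cylinder_take (x : InfPath E) (n : ℕ) : x ∈ (x.take n).cylinder :=
  ⟨rfl, fun _ => rfl⟩

lemma InfPath.mem_take_iff (x y : InfPath E) (n : ℕ) :
    y ∈ (x.take n).cylinder ↔ y.range = x.range ∧ ∀ i < n, y.edge i = x.edge i :=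
  ⟨fun h => ⟨h.1, fun i hi => h.2 ⟨i, hi⟩⟩, fun h => ⟨h.1, fun i => h.2 i i.2⟩⟩

lemma InfPath.eq_of_split {x y : InfPath E} (n : ℕ) (h1 : ∀ i < n, x.edge i = y.edge i)
    (h2 : ∀ i, x.edge (n + i) = y.edge (n + i)) : x = y := by
  ext i
  rcases lt_or_ge i n with h | h
  · exact h1 i h
  · obtain ⟨j, rfl⟩ := Nat.exists_eq_add_of_le h
    exact h2 j

lemma GraphGroupoid.inv_inv (g : GraphGroupoid E) : g.inv.inv = g := by
  ext <;> simp [inv]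

lemma GraphGroupoid.Z_inj {μ ν : FinPath E} {a b : GraphGroupoid E} (ha : a ∈ Z μ ν)
    (hb : b ∈ Z μ ν) (h : a.range = b.range) : a = b := by
  obtain ⟨-, ha2, ha3, ha4⟩ := ha
  obtain ⟨-, hb2, hb3, hb4⟩ := hb
  refine GraphGroupoid.ext h (ha3.trans hb3.symm) (InfPath.eq_of_split ν.length ?_ ?_)
  · intro i hi
    exact (ha2.2 ⟨i, hi⟩).trans (hb2.2 ⟨i, hi⟩).symm
  · intro i
    rw [← ha4, ← hb4, h]

lemma GraphGroupoid.inv_mem_Z {μ ν : FinPath E} {a : GraphGroupoid E} :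
    a.inv ∈ Z μ ν ↔ a ∈ Z ν μ := by
  constructor
  · rintro ⟨h1, h2, h3, h4⟩
    refine ⟨h2, h1, ?_, fun i => (h4 i).symm⟩
    simp only [inv] at h3
    omega
  · rintro ⟨h1, h2, h3, h4⟩
    refine ⟨h2, h1, ?_, fun i => (h4 i).symm⟩
    simp only [inv]
    omega

/-- The set product in the groupoid. -/
def mulSet (A B : Set (GraphGroupoid E)) : Set (GraphGroupoid E) :=
  {g | ∃ a ∈ A, ∃ b ∈ B, ∃ h : a.source = b.range, g = a.comp b h}

lemma inv_comp_comp (a b : GraphGroupoid E) (h : a.source = b.range) :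
    a.inv.comp (a.comp b h) rfl = b := by
  ext <;> simp [inv, comp, h]

lemma comp_inv_comp (a g : GraphGroupoid E) (h : a.range = g.range) :
    a.comp (a.inv.comp g h) rfl = g := by
  ext <;> simp [inv, comp, h]

/-- A set of groupoid elements on which the range map is injective. -/
def RInj (A : Set (GraphGroupoid E)) : Prop := ∀ a ∈ A, ∀ b ∈ A, a.range = b.range → a = b

lemma rInj_Z (μ ν : FinPath E) : RInj (Z μ ν) := fun _ ha _ hb h => Z_inj ha hb h

lemma conv_char_of_mem {A : Set (GraphGroupoid E)} (hA : RInj A) (h : GraphGroupoid E → R)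
    {a γ : GraphGroupoid E} (ha : a ∈ A) (hr : a.range = γ.range) :
    conv (charFun R A) h γ = h (a.inv.comp γ hr) := by
  unfold conv
  rw [finsum_eq_single _ (⟨a, hr⟩ : {η : GraphGroupoid E // η.range = γ.range})]
  · simp [charFun, ha]
  · rintro ⟨η, hη⟩ hne
    have : η ∉ A := fun hηA => hne (Subtype.ext (hA _ hηA _ ha (hη.trans hr.symm)))
    simp [charFun, this]

lemma conv_char_of_not {A : Set (GraphGroupoid E)} (h : GraphGroupoid E → R)
    {γ : GraphGroupoid E} (hn : ∀ a ∈ A, a.range ≠ γ.range) :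
    conv (charFun R A) h γ = 0 := by
  unfold conv
  refine finsum_eq_zero_of_forall_eq_zero ?_
  rintro ⟨η, hη⟩
  have : η ∉ A := fun hηA => hn _ hηA hη
  simp [charFun, this]

lemma conv_char_char {A B : Set (GraphGroupoid E)} (hA : RInj A) :
    conv (charFun R A) (charFun R B) = charFun R (mulSet A B) := by
  classical
  funext γ
  by_cases h : ∃ a ∈ A, a.range = γ.range
  · obtain ⟨a, ha, hr⟩ := h
    rw [conv_char_of_mem hA _ ha hr]
    have : a.inv.comp γ hr ∈ B ↔ γ ∈ mulSet A B := by
      constructor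
      · intro hB
        exact ⟨a, ha, _, hB, rfl, (comp_inv_comp a γ hr).symm⟩
      · rintro ⟨a', ha', b, hb, hab, rfl⟩
        obtain rfl := hA _ ha _ ha' hr
        rwa [inv_comp_comp]
    simp only [charFun, Set.indicator_apply, this]
  · push Not at h
    rw [conv_char_of_not _ h]
    have : γ ∉ mulSet A B := by
      rintro ⟨a', ha', b, hb, hab, rfl⟩
      exact h _ ha' rfl
    simp [charFun, this]

lemma RInj.mulSet {A B : Set (GraphGroupoid E)} (hA : RInj A) (hB : RInj B) :
    RInj (mulSet A B) := by
  rintro _ ⟨a, ha, b, hb, hab, rfl⟩ _ ⟨a', ha', b', hb', hab', rfl⟩ h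
  obtain rfl := hA _ ha _ ha' h
  obtain rfl := hB _ hb _ hb' (hab.symm.trans hab')
  rfl

lemma conv_char_assoc {A B : Set (GraphGroupoid E)} (hA : RInj A) (hB : RInj B)
    (h : GraphGroupoid E → R) :
    conv (charFun R A) (conv (charFun R B) h) = conv (charFun R (mulSet A B)) h := by
  funext γ
  by_cases h1 : ∃ a ∈ A, a.range = γ.range
  · obtain ⟨a, ha, hr⟩ := h1
    rw [conv_char_of_mem hA _ ha hr]
    by_cases h2 : ∃ b ∈ B, b.range = a.source
    · obtain ⟨b, hb, hrb⟩ := h2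
      rw [conv_char_of_mem (γ := a.inv.comp γ hr) hB _ hb hrb]
      rw [conv_char_of_mem (hA.mulSet hB) (a := a.comp b hrb.symm) _
        ⟨a, ha, b, hb, hrb.symm, rfl⟩ hr]
      congr 1
      ext <;> simp [inv, comp]
      ring
    · push Not at h2
      rw [conv_char_of_not _ h2, conv_char_of_not]
      rintro _ ⟨a', ha', b, hb, hab, rfl⟩ hr'
      obtain rfl := hA _ ha _ ha' (hr.trans hr'.symm)
      exact h2 b hb hab.symm
  · push Not at h1
    rw [conv_char_of_not _ h1, conv_char_of_not]
    rintro _ ⟨a', ha', b, hb, hab, rfl⟩ hr'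
    exact h1 a' ha' hr'

/-- Functions with finite support on every range fibre. -/
def RFin (f : GraphGroupoid E → R) : Prop :=
  ∀ x : InfPath E, {η : GraphGroupoid E | η.range = x ∧ f η ≠ 0}.Finite

lemma RFin.add {f g : GraphGroupoid E → R} (hf : RFin f) (hg : RFin g) : RFin (f + g) := by
  intro x
  refine ((hf x).union (hg x)).subset ?_
  rintro η ⟨h1, h2⟩
  by_cases h : f η = 0
  · right
    refine ⟨h1, fun h' => h2 ?_⟩
    simp [h, h']
  · exact Or.inl ⟨h1, h⟩

lemma RFin.smul {f : GraphGroupoid E → R} (hf : RFin f) (c : R) : RFin (c • f) := by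
  intro x
  refine (hf x).subset ?_
  rintro η ⟨h1, h2⟩
  refine ⟨h1, fun h' => h2 ?_⟩
  simp [h']

lemma RFin.char {A : Set (GraphGroupoid E)} (hA : RInj A) : RFin (charFun R A) := by
  intro x
  refine Set.Subsingleton.finite ?_
  rintro a ⟨h1, h2⟩ b ⟨h3, h4⟩
  have ha : a ∈ A := by
    by_contra h
    exact h2 (by simp [charFun, h])
  have hb : b ∈ A := by
    by_contra h
    exact h4 (by simp [charFun, h])
  exact hA _ ha _ hb (h1.trans h3.symm)

lemma rFin_of_mem {f : GraphGroupoid E → R} (hf : f ∈ LPA R E) : RFin f := by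
  induction hf using Submodule.span_induction with
  | mem x h =>
    obtain ⟨p, rfl⟩ := h
    exact RFin.char (rInj_Z _ _)
  | zero => intro x; simp
  | add x y _ _ hx hy => exact hx.add hy
  | smul c x _ hx => exact hx.smul c

lemma RFin.support {f : GraphGroupoid E → R} (hf : RFin f) (γ : GraphGroupoid E)
    (k : {η : GraphGroupoid E // η.range = γ.range} → R) :
    (Function.support fun η : {η : GraphGroupoid E // η.range = γ.range} => f η.1 * k η).Finite := by
  refine Set.Finite.subset (Set.Finite.preimage (Subtype.val_injective.injOn) (hf γ.range)) ?_
  rintro ⟨η, hη⟩ h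
  refine ⟨hη, fun h' => h ?_⟩
  simp [h']

lemma conv_add {f : GraphGroupoid E → R} (hf : RFin f) (g g' : GraphGroupoid E → R) :
    conv f (g + g') = conv f g + conv f g' := by
  funext γ
  simp only [conv, Pi.add_apply, mul_add]
  exact finsum_add_distrib (hf.support γ _) (hf.support γ _)

lemma add_conv {f f' : GraphGroupoid E → R} (hf : RFin f) (hf' : RFin f')
    (g : GraphGroupoid E → R) : conv (f + f') g = conv f g + conv f' g := by
  funext γ
  simp only [conv, Pi.add_apply, add_mul]
  exact finsum_add_distrib (hf.support γ _) (hf'.support γ _)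

lemma smul_conv {f : GraphGroupoid E → R} (hf : RFin f) (c : R)
    (g : GraphGroupoid E → R) : conv (c • f) g = c • conv f g := by
  funext γ
  simp only [conv, Pi.smul_apply, smul_eq_mul, mul_assoc]
  exact (mul_finsum' _ _ (hf.support γ _)).symm

lemma conv_smul {f : GraphGroupoid E → R} (hf : RFin f) (c : R)
    (g : GraphGroupoid E → R) : conv f (c • g) = c • conv f g := by
  funext γ
  simp only [conv, Pi.smul_apply, smul_eq_mul, mul_left_comm _ c]
  exact (mul_finsum' _ _ (hf.support γ _)).symm

lemma zero_conv (g : GraphGroupoid E → R) : conv 0 g = 0 := by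
  funext γ
  simp [conv]

lemma conv_zero (g : GraphGroupoid E → R) : conv g 0 = 0 := by
  funext γ
  simp [conv]

lemma char_empty : charFun R (∅ : Set (GraphGroupoid E)) = 0 := by
  funext γ
  simp [charFun]

lemma char_Z_mem (μ ν : FinPath E) : charFun R (Z μ ν) ∈ LPA R E :=
  Submodule.subset_span ⟨(μ, ν), rfl⟩

lemma mulSet_Z_of_le {μ ν β γ : FinPath E} (hl : ν.length ≤ β.length)
    (hne : (mulSet (Z μ ν) (Z β γ)).Nonempty) : ∃ p q, mulSet (Z μ ν) (Z β γ) = Z p q := by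
  obtain ⟨_, a, ha, b, hb, hab, rfl⟩ := hne
  obtain ⟨ha1, ha2, ha3, ha4⟩ := ha
  obtain ⟨hb1, hb2, hb3, hb4⟩ := hb
  obtain ⟨m, hm⟩ := Nat.exists_eq_add_of_le hl
  refine ⟨a.range.take (μ.length + m), γ, ?_⟩
  ext g
  constructor
  · rintro ⟨a', ⟨h1, h2, h3, h4⟩, b', ⟨k1, k2, k3, k4⟩, h, rfl⟩
    refine ⟨?_, k2, ?_, ?_⟩
    · rw [InfPath.mem_take_iff]
      refine ⟨h1.1.trans ha1.1.symm, fun i hi => ?_⟩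
      rcases lt_or_ge i μ.length with hi' | hi'
      · exact (h1.2 ⟨i, hi'⟩).trans (ha1.2 ⟨i, hi'⟩).symm
      · obtain ⟨j, rfl⟩ := Nat.exists_eq_add_of_le hi'
        change a'.range.edge _ = _
        rw [h4, ha4, h, hab]
        exact (k1.2 ⟨ν.length + j, by omega⟩).trans (hb1.2 ⟨ν.length + j, by omega⟩).symm
    · simp only [comp, InfPath.take]
      push_cast
      omega
    · intro i
      simp only [comp, InfPath.take]
      rw [show μ.length + m + i = μ.length + (m + i) by omega, h4, h,
        show ν.length + (m + i) = β.length + i by omega, k4]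
  · rintro ⟨h1, h2, h3, h4⟩
    rw [InfPath.mem_take_iff] at h1
    simp only [InfPath.take] at h3 h4
    have hbm : ∀ i < β.length, b.range.edge i = a.source.edge i := fun i _ => by rw [hab]
    let y : InfPath E :=
      { edge := fun i => if i < ν.length then a.source.edge i
          else g.range.edge (μ.length + (i - ν.length))
        chain := by
          intro i
          rcases lt_trichotomy (i + 1) ν.length with hi | hi | hi
          · rw [if_pos (by omega), if_pos hi]
            exact a.source.chain i
          · rw [if_pos (by omega), if_neg (by omega), a.source.chain i]
            rcases Nat.eq_zero_or_pos m with hm0 | hm0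
            · have e1 := h4 0
              have e2 := hb4 0
              have e4 := h2
              rw [show i + 1 = ν.length + 0 by omega, ← ha4]
              rw [show μ.length + (ν.length + 0 - ν.length) = μ.length + m + 0 by omega, h4]
              rw [ha4, hab, show ν.length + 0 = β.length + 0 by omega, hb4]
              rcases Nat.eq_zero_or_pos γ.length with hg | hg
              · have := h2.1.trans hb2.1.symm
                simp only [InfPath.range] at this
                simp only [hg]
                exact this.symm
              · obtain ⟨t, ht⟩ : ∃ t, γ.length = t + 1 := ⟨γ.length - 1, by omega⟩
                rw [add_zero, ht, ← g.source.chain t, ← b.source.chain t,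
                  h2.2 ⟨t, by omega⟩, hb2.2 ⟨t, by omega⟩]
            · rw [h1.2 _ (by omega), ha4]
              congr 2
              omega
          · rw [if_neg (by omega), if_neg (by omega), g.range.chain]
            congr 2
            omega }
    have hy1 : ∀ i < ν.length, y.edge i = a.source.edge i := fun i hi => if_pos hi
    have hy2 : ∀ i, y.edge (ν.length + i) = g.range.edge (μ.length + i) := fun i => by
      simp only [y]
      rw [if_neg (by omega)]
      congr 2
      omega
    have hyβ : ∀ i < β.length, y.edge i = b.range.edge i := fun i hi => by
      rcases lt_or_ge i ν.length with hi' | hi'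
      · rw [hy1 i hi', hab]
      · obtain ⟨j, rfl⟩ := Nat.exists_eq_add_of_le hi'
        rw [hy2, h1.2 _ (by omega), ha4, hab]
    have hyr : y.range = b.range.range := by
      rcases Nat.eq_zero_or_pos β.length with hg | hg
      · have e1 := hy2 0
        have e2 := h4 0
        have e3 := hb4 0
        have hm0 : m = 0 := by omega
        have hν : ν.length = 0 := by omega
        simp only [hm0, hν, hg, add_zero] at e1 e2 e3
        simp only [InfPath.range]
        rw [e1, e2, e3]
        rcases Nat.eq_zero_or_pos γ.length with hg | hg
        · have := h2.1.trans hb2.1.symm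
          simp only [InfPath.range] at this
          rw [hg]
          exact this
        · obtain ⟨t, ht⟩ : ∃ t, γ.length = t + 1 := ⟨γ.length - 1, by omega⟩
          rw [ht, ← g.source.chain t, ← b.source.chain t,
            h2.2 ⟨t, by omega⟩, hb2.2 ⟨t, by omega⟩]
      · simp only [InfPath.range]
        rw [hyβ 0 hg]
    refine ⟨⟨g.range, (μ.length : ℤ) - ν.length, y, μ.length, ν.length, rfl,
        fun i => (hy2 i).symm⟩, ⟨⟨h1.1.trans ha1.1, fun i => ?_⟩, ⟨?_, fun i => ?_⟩, rfl,
        fun i => (hy2 i).symm⟩,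
      ⟨y, (β.length : ℤ) - γ.length, g.source, β.length, γ.length, rfl, fun i => ?_⟩,
        ⟨⟨hyr.trans hb1.1, fun i => (hyβ i i.2).trans (hb1.2 i)⟩, h2, rfl, fun i => ?_⟩,
        rfl, ?_⟩
    · exact (h1.2 i (by omega)).trans (ha1.2 i)
    · rw [hyr, ← hab]
      exact ha2.1
    · exact (hy1 i i.2).trans (ha2.2 i)
    · rw [show β.length + i = ν.length + (m + i) by omega, hy2, ← h4]
      congr 1
      omega
    · change y.edge _ = _
      rw [show β.length + i = ν.length + (m + i) by omega, hy2, ← h4]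
      congr 1
      omega
    · refine GraphGroupoid.ext rfl ?_ rfl
      simp only [comp]
      push_cast at h3
      omega

lemma mem_mulSet_inv (μ ν β γ : FinPath E) (g : GraphGroupoid E) :
    g.inv ∈ mulSet (Z γ β) (Z ν μ) ↔ g ∈ mulSet (Z μ ν) (Z β γ) := by
  constructor
  · rintro ⟨a, ha, b, hb, hab, h⟩
    refine ⟨b.inv, inv_mem_Z.2 hb, a.inv, inv_mem_Z.2 ha, hab.symm, ?_⟩
    rw [← g.inv_inv, h]
    ext <;> simp [inv, comp]
  · rintro ⟨a, ha, b, hb, hab, rfl⟩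
    refine ⟨b.inv, inv_mem_Z.2 hb, a.inv, inv_mem_Z.2 ha, hab.symm, ?_⟩
    ext <;> simp [inv, comp]

lemma mulSet_Z (μ ν β γ : FinPath E) : charFun R (mulSet (Z μ ν) (Z β γ)) ∈ LPA R E := by
  rcases Set.eq_empty_or_nonempty (mulSet (Z μ ν) (Z β γ)) with h | h
  · rw [h, char_empty]
    exact zero_mem _
  rcases le_total ν.length β.length with hl | hl
  · obtain ⟨p, q, hpq⟩ := mulSet_Z_of_le hl h
    rw [hpq]
    exact char_Z_mem _ _
  · obtain ⟨g, hg⟩ := h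
    obtain ⟨p, q, hpq⟩ := mulSet_Z_of_le (μ := γ) (γ := μ) hl
      ⟨g.inv, (mem_mulSet_inv _ _ _ _ _).2 hg⟩
    have : mulSet (Z μ ν) (Z β γ) = Z q p := by
      ext g
      rw [← mem_mulSet_inv, hpq, inv_mem_Z]
    rw [this]
    exact char_Z_mem _ _

lemma conv_mem {f g : GraphGroupoid E → R} (hf : f ∈ LPA R E) (hg : g ∈ LPA R E) :
    conv f g ∈ LPA R E := by
  induction hf using Submodule.span_induction with
  | mem x h =>
    obtain ⟨p, rfl⟩ := h
    induction hg using Submodule.span_induction with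
    | mem y h =>
      obtain ⟨q, rfl⟩ := h
      simp only
      rw [conv_char_char (rInj_Z _ _)]
      exact mulSet_Z _ _ _ _
    | zero => rw [conv_zero]; exact zero_mem _
    | add y z _ _ hy hz =>
      rw [conv_add (RFin.char (rInj_Z _ _))]
      exact add_mem hy hz
    | smul c y _ hy =>
      rw [conv_smul (RFin.char (rInj_Z _ _))]
      exact Submodule.smul_mem _ _ hy
  | zero => rw [zero_conv]; exact zero_mem _
  | add y z hy' hz' hy hz =>
    rw [add_conv (rFin_of_mem hy') (rFin_of_mem hz')]
    exact add_mem hy hz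
  | smul c y hy' hy =>
    rw [smul_conv (rFin_of_mem hy')]
    exact Submodule.smul_mem _ _ hy

lemma conv_assoc {f g : GraphGroupoid E → R} (hf : f ∈ LPA R E) (hg : g ∈ LPA R E)
    (h : GraphGroupoid E → R) : conv (conv f g) h = conv f (conv g h) := by
  induction hf using Submodule.span_induction with
  | mem x hx =>
    obtain ⟨p, rfl⟩ := hx
    induction hg using Submodule.span_induction with
    | mem y hy =>
      obtain ⟨q, rfl⟩ := hy
      simp only
      rw [conv_char_char (rInj_Z _ _), conv_char_assoc (rInj_Z _ _) (rInj_Z _ _)]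
    | zero => simp only [conv_zero, zero_conv]
    | add y z hy' hz' hy hz =>
      have hp : RFin (charFun R (Z p.1 p.2)) := RFin.char (rInj_Z _ _)
      rw [conv_add hp, add_conv (rFin_of_mem (conv_mem (char_Z_mem _ _) hy'))
        (rFin_of_mem (conv_mem (char_Z_mem _ _) hz')), add_conv (rFin_of_mem hy')
        (rFin_of_mem hz'), conv_add hp]
      exact congrArg₂ _ hy hz
    | smul c y hy' hy =>
      have hp : RFin (charFun R (Z p.1 p.2)) := RFin.char (rInj_Z _ _)
      rw [conv_smul hp, smul_conv (rFin_of_mem (conv_mem (char_Z_mem _ _) hy')),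
        smul_conv (rFin_of_mem hy'), conv_smul hp]
      exact congrArg _ hy
  | zero => simp only [zero_conv]
  | add y z hy' hz' hy hz =>
    rw [add_conv (rFin_of_mem hy') (rFin_of_mem hz'), add_conv (rFin_of_mem (conv_mem hy' hg))
      (rFin_of_mem (conv_mem hz' hg)), add_conv (rFin_of_mem hy') (rFin_of_mem hz'), hy, hz]
  | smul c y hy' hy =>
    rw [smul_conv (rFin_of_mem hy'), smul_conv (rFin_of_mem (conv_mem hy' hg)),
      smul_conv (rFin_of_mem hy'), hy]

lemma convStar_mem [StarRing R] {f : GraphGroupoid E → R} (hf : f ∈ LPA R E) :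
    convStar f ∈ LPA R E := by
  classical
  induction hf using Submodule.span_induction with
  | mem x h =>
    obtain ⟨p, rfl⟩ := h
    have : convStar (charFun R (Z p.1 p.2)) = charFun R (Z p.2 p.1) := by
      funext g
      simp only [convStar, charFun, Set.indicator_apply, inv_mem_Z]
      split_ifs <;> simp
    simp only [this]
    exact char_Z_mem _ _
  | zero =>
    have : convStar (0 : GraphGroupoid E → R) = 0 := by funext g; simp [convStar]
    rw [this]
    exact zero_mem _
  | add y z _ _ hy hz =>
    have : convStar (y + z) = convStar y + convStar z := by funext g; simp [convStar]
    rw [this]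
    exact add_mem hy hz
  | smul c y _ hy =>
    have : convStar (c • y) = star c • convStar y := by funext g; simp [convStar]
    rw [this]
    exact Submodule.smul_mem _ _ hy

/-- Translation of range fibres. -/
def fibreEquiv (γ : GraphGroupoid E) :
    {η : GraphGroupoid E // η.range = γ.source} ≃ {ζ : GraphGroupoid E // ζ.range = γ.range} where
  toFun η := ⟨γ.comp η.1 η.2.symm, rfl⟩
  invFun ζ := ⟨γ.inv.comp ζ.1 ζ.2.symm, rfl⟩
  left_inv η := Subtype.ext (inv_comp_comp _ _ η.2.symm)
  right_inv ζ := Subtype.ext (comp_inv_comp _ _ ζ.2.symm)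

lemma convStar_conv [StarRing R] (f g : GraphGroupoid E → R) :
    convStar (conv f g) = conv (convStar g) (convStar f) := by
  funext γ
  change starAddEquiv (∑ᶠ η : {η : GraphGroupoid E // η.range = γ.source},
    f η.1 * g (η.1.inv.comp γ.inv η.2)) = _
  rw [AddEquiv.map_finsum, conv, ← finsum_comp_equiv (fibreEquiv γ)]
  refine finsum_congr fun η => ?_
  simp only [starAddEquiv_apply, star_mul, convStar, fibreEquiv, Equiv.coe_fn_mk]
  congr 2
  · congr 1
    ext <;> simp [inv, comp]
  · congr 1
    ext <;> simp [inv, comp, η.2]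

end aux

noncomputable instance : Mul (LPA R E) := ⟨fun f g => ⟨conv f.1 g.1, conv_mem f.2 g.2⟩⟩

noncomputable instance [StarRing R] : Star (LPA R E) := ⟨fun f => ⟨convStar f.1, convStar_mem f.2⟩⟩

lemma coe_mul (f g : LPA R E) : (f * g).1 = conv f.1 g.1 := rfl

lemma coe_star [StarRing R] (f : LPA R E) : (star f).1 = convStar f.1 := rfl

noncomputable instance : NonUnitalRing (LPA R E) :=
  { (inferInstance : AddCommGroup (LPA R E)) with
    mul := (· * ·)
    left_distrib := fun a b c => Subtype.ext (conv_add (rFin_of_mem a.2) b.1 c.1)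
    right_distrib := fun a b c => Subtype.ext (add_conv (rFin_of_mem a.2) (rFin_of_mem b.2) c.1)
    zero_mul := fun a => Subtype.ext (zero_conv a.1)
    mul_zero := fun a => Subtype.ext (conv_zero a.1)
    mul_assoc := fun a b c => Subtype.ext (conv_assoc a.2 b.2 c.1) }

noncomputable instance [StarRing R] : StarRing (LPA R E) where
  star_involutive f := Subtype.ext (by
    funext g
    simp only [coe_star, convStar, g.inv_inv, star_star])
  star_mul f g := Subtype.ext (convStar_conv f.1 g.1)
  star_add f g := Subtype.ext (by
    funext γ
    simp [coe_star, convStar])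

/-- The element `1_{Z(μ, ν)}` of `L_R(E)`. -/
noncomputable def LPA.char (R : Type w) [CommRing R] (μ ν : FinPath E) : LPA R E :=
  ⟨charFun R (Z μ ν), char_Z_mem μ ν⟩

/-- The diagonal `D(E)`: the `R`-linear span of the elements `1_{Z(μ)} = 1_{Z(μ, μ)}`. -/
noncomputable def diagonal (R : Type w) [CommRing R] (E : DirectedGraph.{u, v}) :
    Submodule R (LPA R E) :=
  Submodule.span R (Set.range fun μ : FinPath E => LPA.char R μ μ)

/-- The normalizers `N(E)` of the diagonal. -/
def normalizers (R : Type w) [CommRing R] [StarRing R] (E : DirectedGraph.{u, v}) :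
    Set (LPA R E) :=
  {n | ∀ d ∈ diagonal R E, n * d * star n ∈ diagonal R E ∧ star n * d * n ∈ diagonal R E}

/-- The domain `dom(n) = supp(n*n)` of a normalizer, as a subset of the infinite-path space, which
is identified with the unit space of `G_E`. -/
def dom [StarRing R] (n : LPA R E) : Set (InfPath E) := {x | (star n * n).1 (unit x) ≠ 0}

open Classical in
/-- The partial action `αₙ(x)`: the range of the elements of `supp(n)` with source `x`
(with value `x` if there is no such element). -/
noncomputable def alpha (n : LPA R E) (x : InfPath E) : InfPath E :=
  if h : ∃ g : GraphGroupoid E, n.1 g ≠ 0 ∧ g.source = x then h.choose.range else x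

/-- The infinite path `x` is isolated. -/
def IsIsolated (x : InfPath E) : Prop := IsOpen ({x} : Set (InfPath E))

/-- The function `f` is homogeneous of degree `k`, that is, its support consists of groupoid
elements of the form `(x, k, y)`. -/
def IsHomogeneous (f : GraphGroupoid E → R) (k : ℤ) : Prop := ∀ g, f g ≠ 0 → g.lag = k

/-- The function `pₓ = 1_{x}`, the characteristic function of the unit at `x`. -/
noncomputable def pointFun (R : Type w) [CommRing R] (x : InfPath E) : GraphGroupoid E → R :=
  charFun R {unit x}

/-- The pairs `(n, x)` with `n ∈ N(E)` and `x ∈ dom(n)`. -/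
structure WeylPair (R : Type w) [CommRing R] [StarRing R] (E : DirectedGraph.{u, v}) where
  n : LPA R E
  x : InfPath E
  n_mem : n ∈ normalizers R E
  x_mem : x ∈ dom n

/-- The relation `(n, x) ∼ (m, x')`: one has `x = x'` and either `x` is isolated, `αₙ(x) = αₘ(x)`
and `pₓ n* m pₓ` has degree `0`, or `x` is not isolated and `αₙ` and `αₘ` agree on an open
neighbourhood `V ⊆ dom(n) ∩ dom(m)` of `x`. -/
def WeylRel [StarRing R] (p q : WeylPair R E) : Prop :=
  p.x = q.x ∧
    ((IsIsolated p.x ∧ alpha p.n p.x = alpha q.n p.x ∧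
        IsHomogeneous
          (conv (conv (pointFun R p.x) (star p.n * q.n).1) (pointFun R p.x)) 0) ∨
      (¬ IsIsolated p.x ∧ ∃ V : Set (InfPath E), IsOpen V ∧ p.x ∈ V ∧ V ⊆ dom p.n ∩ dom q.n ∧
        ∀ y ∈ V, alpha p.n y = alpha q.n y))

/-! ### The Weyl relation is an equivalence relation -/

section weyl

lemma unit_of_mem_Z {μ : FinPath E} {g : GraphGroupoid E} (h : g ∈ Z μ μ) : g = unit g.source := by
  obtain ⟨h1, h2, h3, h4⟩ := h
  refine GraphGroupoid.ext (InfPath.eq_of_split μ.length ?_ h4) (by simp [h3, unit]) rfl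
  intro i hi
  exact (h1.2 ⟨i, hi⟩).trans (h2.2 ⟨i, hi⟩).symm

lemma unit_mem_Z {μ : FinPath E} {x : InfPath E} : unit x ∈ Z μ μ ↔ x ∈ μ.cylinder :=
  ⟨fun h => h.1, fun h => ⟨h, h, by simp [unit], fun _ => rfl⟩⟩

lemma diag_unit {d : LPA R E} (hd : d ∈ diagonal R E) {g : GraphGroupoid E} (hg : d.1 g ≠ 0) :
    g = unit g.source := by
  induction hd using Submodule.span_induction with
  | mem x h =>
    obtain ⟨μ, rfl⟩ := h
    refine unit_of_mem_Z (μ := μ) ?_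
    by_contra h
    exact hg (by simp [LPA.char, charFun, h])
  | zero => exact absurd rfl hg
  | add y z _ _ hy hz =>
    by_cases h : y.1 g = 0
    · exact hz fun h' => hg (by simp [h, h'])
    · exact hy h
  | smul c y _ hy => exact hy fun h' => hg (by simp [h'])

lemma conv_eq_single (f g : GraphGroupoid E → R) (γ a : GraphGroupoid E) (ha : a.range = γ.range)
    (h : ∀ (η : GraphGroupoid E) (hη : η.range = γ.range), f η ≠ 0 → g (η.inv.comp γ hη) ≠ 0 →
      η = a) : conv f g γ = f a * g (a.inv.comp γ ha) := by
  unfold conv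
  rw [finsum_eq_single _ (⟨a, ha⟩ : {η : GraphGroupoid E // η.range = γ.range})]
  rintro ⟨η, hη⟩ hne
  by_contra hc
  exact hne (Subtype.ext (h η hη (left_ne_zero_of_mul hc) (right_ne_zero_of_mul hc)))

lemma exists_of_conv_ne {f g : GraphGroupoid E → R} {γ : GraphGroupoid E} (h : conv f g γ ≠ 0) :
    ∃ (η ζ : GraphGroupoid E) (hh : η.source = ζ.range), γ = η.comp ζ hh ∧ f η ≠ 0 ∧ g ζ ≠ 0 := by
  obtain ⟨⟨η, hη⟩, h'⟩ : ∃ η : {η : GraphGroupoid E // η.range = γ.range},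
      f η.1 * g (η.1.inv.comp γ η.2) ≠ 0 := by
    by_contra hc
    push Not at hc
    exact h (finsum_eq_zero_of_forall_eq_zero hc)
  exact ⟨η, _, rfl, (comp_inv_comp _ _ hη).symm, left_ne_zero_of_mul h', right_ne_zero_of_mul h'⟩

/-- Right multiplication by a function supported on the units. -/
lemma conv_unit (f d : GraphGroupoid E → R) (hd : ∀ g, d g ≠ 0 → g = unit g.source)
    (γ : GraphGroupoid E) : conv f d γ = f γ * d (unit γ.source) := by
  rw [conv_eq_single f d γ γ rfl]
  · congr 2
    ext <;> simp [inv, comp, unit]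
  · intro η hη _ h
    have := hd _ h
    have h1 := congrArg GraphGroupoid.lag this
    have h2 := congrArg GraphGroupoid.range this
    refine GraphGroupoid.ext hη ?_ h2
    simp only [inv, comp, unit] at h1
    omega

/-- Left multiplication by a function supported on the units. -/
lemma unit_conv (f d : GraphGroupoid E → R) (hd : ∀ g, d g ≠ 0 → g = unit g.source)
    (γ : GraphGroupoid E) : conv d f γ = d (unit γ.range) * f γ := by
  rw [conv_eq_single d f γ (unit γ.range) rfl]
  · congr 2
    ext <;> simp [inv, comp, unit]
  · intro η hη h _
    have h1 := hd _ h
    have h2 : η.range = η.source := congrArg GraphGroupoid.range h1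
    rw [h1, ← h2, hη]

lemma exists_take_sep {S : Set (InfPath E)} (hS : S.Finite) (y : InfPath E) :
    ∃ k, ∀ z ∈ S, z ∈ (y.take k).cylinder → z = y := by
  suffices h : ∀ᶠ k in Filter.atTop, ∀ z ∈ S, z ∈ (y.take k).cylinder → z = y from h.exists
  rw [Filter.eventually_all_finite hS]
  intro z _
  by_cases hzy : z = y
  · exact Filter.Eventually.of_forall fun _ _ => hzy
  · have : ∃ i, z.edge i ≠ y.edge i := by
      by_contra hc
      push Not at hc
      exact hzy (InfPath.ext (funext hc))
    obtain ⟨i, hi⟩ := this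
    filter_upwards [Filter.eventually_gt_atTop i] with k hk hz
    exact absurd (((InfPath.mem_take_iff y z k).1 hz).2 i hk) hi

lemma char_mem_diag (μ : FinPath E) : LPA.char R μ μ ∈ diagonal R E :=
  Submodule.subset_span ⟨μ, rfl⟩

variable [StarRing R]

lemma star_mem_normalizers {n : LPA R E} (hn : n ∈ normalizers R E) :
    star n ∈ normalizers R E := fun d hd => by
  rw [star_star]
  exact (hn d hd).symm

lemma mul_mem_normalizers {m n : LPA R E} (hm : m ∈ normalizers R E) (hn : n ∈ normalizers R E) :
    m * n ∈ normalizers R E := fun d hd => by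
  constructor
  · have := (hm _ (hn d hd).1).1
    simpa only [star_mul, mul_assoc] using this
  · have := (hn _ (hm d hd).2).2
    simpa only [star_mul, mul_assoc] using this

lemma star_ne {n : LPA R E} {g : GraphGroupoid E} : (star n).1 g ≠ 0 ↔ n.1 g.inv ≠ 0 := by
  simp [coe_star, convStar]

variable [IsDomain R]

lemma supp_source_aux {n : LPA R E} (hn : n ∈ normalizers R E) {a b : GraphGroupoid E}
    (ha : n.1 a ≠ 0) (hb : n.1 b ≠ 0) (hab : a.source = b.source)
    (hmax : ∀ c : GraphGroupoid E, n.1 c ≠ 0 → c.range = a.range → c.source = a.source →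
      c.lag ≤ a.lag)
    (hmin : ∀ c : GraphGroupoid E, n.1 c ≠ 0 → c.range = b.range → c.source = b.source →
      b.lag ≤ c.lag) : a = b := by
  obtain ⟨k, hk⟩ := exists_take_sep
    (S := GraphGroupoid.source '' {η : GraphGroupoid E | η.range = a.range ∧ n.1 η ≠ 0})
    ((rFin_of_mem n.2 a.range).image _) a.source
  have hD := (hn _ (char_mem_diag (R := R) (a.source.take k))).1
  have hab' : a.source = b.inv.range := hab
  have hv : (n * LPA.char R (a.source.take k) (a.source.take k) * star n).1
      (a.comp b.inv hab') ≠ 0 := by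
    have hu : ∀ g, (LPA.char R (a.source.take k) (a.source.take k)).1 g ≠ 0 →
      g = unit g.source := fun g hg => diag_unit (char_mem_diag _) hg
    rw [coe_mul, coe_mul, conv_eq_single _ _ (a.comp b.inv hab') a rfl]
    · rw [conv_unit _ _ hu, inv_comp_comp]
      have h1 : (LPA.char R (a.source.take k) (a.source.take k)).1 (unit a.source) = 1 := by
        have : unit a.source ∈ Z (a.source.take k) (a.source.take k) :=
          unit_mem_Z.2 (InfPath.mem_cylinder_take _ _)
        simp [LPA.char, charFun, this]
      rw [h1, mul_one]
      exact mul_ne_zero ha (star_ne.2 (by rwa [GraphGroupoid.inv_inv]))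
    · intro η hη h1 h2
      rw [conv_unit _ _ hu] at h1
      have hnη := left_ne_zero_of_mul h1
      have hs : η.source ∈ (a.source.take k).cylinder := by
        by_contra hc
        have : unit η.source ∉ Z (a.source.take k) (a.source.take k) :=
          fun h => hc (unit_mem_Z.1 h)
        exact right_ne_zero_of_mul h1 (by simp [LPA.char, charFun, this])
      have hsrc : η.source = a.source := hk _ ⟨η, ⟨hη, hnη⟩, rfl⟩ hs
      have h3 := hmin _ (star_ne.1 h2) rfl (hsrc.trans hab)
      have h4 := hmax _ hnη hη hsrc
      refine GraphGroupoid.ext hη ?_ hsrc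
      simp only [inv, comp] at h3
      omega
  have hfin := diag_unit hD hv
  have h1 := congrArg GraphGroupoid.lag hfin
  have h2 := congrArg GraphGroupoid.range hfin
  refine GraphGroupoid.ext h2 ?_ hab
  simp only [inv, comp, unit] at h1
  omega

/-- The support of a normalizer has at most one element with a given source. -/
lemma supp_source_inj {n : LPA R E} (hn : n ∈ normalizers R E) {a b : GraphGroupoid E}
    (ha : n.1 a ≠ 0) (hb : n.1 b ≠ 0) (hab : a.source = b.source) : a = b := by
  have hfin : ∀ c : GraphGroupoid E, {η : GraphGroupoid E | (n.1 η ≠ 0 ∧ η.range = c.range) ∧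
      η.source = c.source}.Finite := fun c =>
    (rFin_of_mem n.2 c.range).subset fun η h => ⟨h.1.2, h.1.1⟩
  have hM : ∀ c, n.1 c ≠ 0 → ∃ M, n.1 M ≠ 0 ∧ M.range = c.range ∧ M.source = c.source ∧
      ∀ e : GraphGroupoid E, n.1 e ≠ 0 → e.range = c.range → e.source = c.source →
        e.lag ≤ M.lag := by
    intro c hc
    obtain ⟨M, hM, hM'⟩ := Set.exists_max_image _ GraphGroupoid.lag (hfin c) ⟨c, ⟨hc, rfl⟩, rfl⟩
    exact ⟨M, hM.1.1, hM.1.2, hM.2, fun e h1 h2 h3 => hM' e ⟨⟨h1, h2⟩, h3⟩⟩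
  have hm : ∀ c, n.1 c ≠ 0 → ∃ M, n.1 M ≠ 0 ∧ M.range = c.range ∧ M.source = c.source ∧
      ∀ e : GraphGroupoid E, n.1 e ≠ 0 → e.range = c.range → e.source = c.source →
        M.lag ≤ e.lag := by
    intro c hc
    obtain ⟨M, hM, hM'⟩ := Set.exists_min_image _ GraphGroupoid.lag (hfin c) ⟨c, ⟨hc, rfl⟩, rfl⟩
    exact ⟨M, hM.1.1, hM.1.2, hM.2, fun e h1 h2 h3 => hM' e ⟨⟨h1, h2⟩, h3⟩⟩
  have main : ∀ c e : GraphGroupoid E, n.1 c ≠ 0 → n.1 e ≠ 0 → c.source = e.source →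
      c.range = e.range ∧ e.lag ≤ c.lag := by
    intro c e hc he hce
    obtain ⟨M, h1, h2, h3, h4⟩ := hM e he
    obtain ⟨m, k1, k2, k3, k4⟩ := hm c hc
    have := supp_source_aux hn h1 k1 (h3.trans (hce.symm.trans k3.symm))
      (fun x hx hx1 hx2 => h4 x hx (hx1.trans h2) (hx2.trans h3))
      (fun x hx hx1 hx2 => k4 x hx (hx1.trans k2) (hx2.trans k3))
    subst this
    exact ⟨k2.symm.trans h2, (h4 e he rfl rfl).trans (k4 c hc rfl rfl)⟩
  have h1 := main a b ha hb hab
  have h2 := main b a hb ha hab.symm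
  exact GraphGroupoid.ext h1.1 (le_antisymm h2.2 h1.2) hab

lemma supp_range_inj {n : LPA R E} (hn : n ∈ normalizers R E) {a b : GraphGroupoid E}
    (ha : n.1 a ≠ 0) (hb : n.1 b ≠ 0) (hab : a.range = b.range) : a = b := by
  have := supp_source_inj (star_mem_normalizers hn) (a := a.inv) (b := b.inv)
    (star_ne.2 (by rwa [inv_inv])) (star_ne.2 (by rwa [inv_inv])) hab
  rw [← a.inv_inv, this, b.inv_inv]

lemma mul_apply_comp {m n : LPA R E} (hm : m ∈ normalizers R E) {a b : GraphGroupoid E}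
    (ha : m.1 a ≠ 0) (hab : a.source = b.range) :
    (m * n).1 (a.comp b hab) = m.1 a * n.1 b := by
  rw [coe_mul, conv_eq_single _ _ (a.comp b hab) a rfl, inv_comp_comp]
  intro η hη h1 _
  exact supp_range_inj hm h1 ha hη

lemma mem_dom {n : LPA R E} (hn : n ∈ normalizers R E) {x : InfPath E} :
    x ∈ dom n ↔ ∃ g : GraphGroupoid E, n.1 g ≠ 0 ∧ g.source = x := by
  constructor
  · intro h
    obtain ⟨η, ζ, hh, h1, h2, h3⟩ := exists_of_conv_ne h
    exact ⟨ζ, h3, (congrArg GraphGroupoid.source h1).symm⟩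
  · rintro ⟨g, hg, rfl⟩
    have h1 : (star n).1 g.inv ≠ 0 := star_ne.2 (by rwa [inv_inv])
    have h2 := mul_apply_comp (n := n) (star_mem_normalizers hn) (b := g) h1 rfl
    have h3 : unit g.source = g.inv.comp g rfl := by ext <;> simp [unit, comp, inv]
    change (star n * n).1 (unit g.source) ≠ 0
    rw [h3, h2]
    exact mul_ne_zero h1 hg

lemma alpha_eq {n : LPA R E} (hn : n ∈ normalizers R E) {g : GraphGroupoid E} (hg : n.1 g ≠ 0) :
    alpha n g.source = g.range := by
  have h : ∃ a : GraphGroupoid E, n.1 a ≠ 0 ∧ a.source = g.source := ⟨g, hg, rfl⟩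
  rw [alpha, dif_pos h, supp_source_inj hn h.choose_spec.1 hg h.choose_spec.2]

lemma comp_ne {m n : LPA R E} (hm : m ∈ normalizers R E) {a b : GraphGroupoid E}
    (ha : m.1 a ≠ 0) (hb : n.1 b ≠ 0) (hab : a.source = b.range) :
    (m * n).1 (a.comp b hab) ≠ 0 := by
  rw [mul_apply_comp hm ha]
  exact mul_ne_zero ha hb

lemma inv_ne {n : LPA R E} {a : GraphGroupoid E} (ha : n.1 a ≠ 0) : (star n).1 a.inv ≠ 0 :=
  star_ne.2 (by rwa [GraphGroupoid.inv_inv])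

lemma inv_comp_self (a : GraphGroupoid E) : a.inv.comp a rfl = unit a.source := by
  ext <;> simp [unit, comp, inv]

lemma comp_inv_self (a : GraphGroupoid E) : a.comp a.inv rfl = unit a.range := by
  ext <;> simp [unit, comp, inv]

lemma isOpen_cylinder (μ : FinPath E) : IsOpen μ.cylinder :=
  TopologicalSpace.isOpen_generateFrom_of_mem ⟨μ, rfl⟩

/-- The initial segments of `x` give a neighbourhood base. -/
lemma exists_take_subset {V : Set (InfPath E)} (hV : IsOpen V) {x : InfPath E} (hx : x ∈ V) :
    ∃ k, ∀ l ≥ k, (x.take l).cylinder ⊆ V := by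
  induction hV with
  | basic s hs =>
    obtain ⟨μ, rfl⟩ := hs
    refine ⟨μ.length, fun l hl y hy => ?_⟩
    rw [InfPath.mem_take_iff] at hy
    exact ⟨hy.1.trans hx.1, fun i => (hy.2 i (by omega)).trans (hx.2 i)⟩
  | univ => exact ⟨0, fun _ _ => Set.subset_univ _⟩
  | inter s t _ _ hs ht =>
    obtain ⟨k, hk⟩ := hs hx.1
    obtain ⟨k', hk'⟩ := ht hx.2
    exact ⟨max k k', fun l hl => Set.subset_inter (hk l (le_trans (le_max_left _ _) hl))
      (hk' l (le_trans (le_max_right _ _) hl))⟩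
  | sUnion S _ ih =>
    obtain ⟨s, hs, hxs⟩ := hx
    obtain ⟨k, hk⟩ := ih s hs hxs
    exact ⟨k, fun l hl => (hk l hl).trans (Set.subset_sUnion_of_mem hs)⟩

/-- Elements of `L_R(E)` are locally constant. -/
lemma locally_const {f : GraphGroupoid E → R} (hf : f ∈ LPA R E) (g : GraphGroupoid E) :
    ∃ N : ℕ, ∀ p q : ℕ, N ≤ p → N ≤ q → ∀ h ∈ Z (g.range.take p) (g.source.take q),
      h.lag = g.lag → f h = f g := by
  classical
  induction hf using Submodule.span_induction with
  | mem x hx =>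
    obtain ⟨⟨μ, ν⟩, rfl⟩ := hx
    obtain ⟨a, b, hab, htail⟩ := g.shift
    refine ⟨μ.length + ν.length + a + b, fun p q hp hq h hh hl => ?_⟩
    obtain ⟨h1, h2, h3, h4⟩ := hh
    rw [InfPath.mem_take_iff] at h1 h2
    have key : h ∈ Z μ ν ↔ g ∈ Z μ ν := by
      simp only [InfPath.take] at h3 h4
      have hr : h.range ∈ μ.cylinder ↔ g.range ∈ μ.cylinder := by
        constructor
        · exact fun k => ⟨h1.1.symm.trans k.1,
            fun i => (h1.2 i (by omega)).symm.trans (k.2 i)⟩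
        · exact fun k => ⟨h1.1.trans k.1, fun i => (h1.2 i (by omega)).trans (k.2 i)⟩
      have hs : h.source ∈ ν.cylinder ↔ g.source ∈ ν.cylinder := by
        constructor
        · exact fun k => ⟨h2.1.symm.trans k.1,
            fun i => (h2.2 i (by omega)).symm.trans (k.2 i)⟩
        · exact fun k => ⟨h2.1.trans k.1, fun i => (h2.2 i (by omega)).trans (k.2 i)⟩
      have ht : g.lag = (μ.length : ℤ) - ν.length →
          ((∀ i : ℕ, h.range.edge (μ.length + i) = h.source.edge (ν.length + i)) ↔
            ∀ i : ℕ, g.range.edge (μ.length + i) = g.source.edge (ν.length + i)) := by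
        intro hμν
        refine forall_congr' fun i => ?_
        rcases lt_or_ge (μ.length + i) p with hi | hi
        · rw [h1.2 _ hi, h2.2 _ (by omega)]
        · refine iff_of_true ?_ ?_
          · have := h4 (μ.length + i - p)
            rwa [show p + (μ.length + i - p) = μ.length + i by omega,
              show q + (μ.length + i - p) = ν.length + i by omega] at this
          · have := htail (μ.length + i - a)
            rwa [show a + (μ.length + i - a) = μ.length + i by omega,
              show b + (μ.length + i - a) = ν.length + i by omega] at this
      constructor
      · rintro ⟨k1, k2, k3, k4⟩
        exact ⟨hr.1 k1, hs.1 k2, hl.symm.trans k3, (ht (hl.symm.trans k3)).1 k4⟩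
      · rintro ⟨k1, k2, k3, k4⟩
        exact ⟨hr.2 k1, hs.2 k2, hl.trans k3, (ht k3).2 k4⟩
    simp only [charFun, Set.indicator_apply, key]
  | zero => exact ⟨0, fun _ _ _ _ _ _ _ => rfl⟩
  | add y z _ _ hy hz =>
    obtain ⟨k, hk⟩ := hy
    obtain ⟨k', hk'⟩ := hz
    refine ⟨max k k', fun p q hp hq h hh hl => ?_⟩
    simp only [max_le_iff] at hp hq
    exact congrArg₂ (· + ·) (hk p q hp.1 hq.1 h hh hl) (hk' p q hp.2 hq.2 h hh hl)
  | smul c y _ hy =>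
    obtain ⟨k, hk⟩ := hy
    exact ⟨k, fun p q hp hq h hh hl => congrArg (c • ·) (hk p q hp hq h hh hl)⟩

/-- Local sections of the source map inside the support of a function in `L_R(E)`. -/
lemma exists_section {f : GraphGroupoid E → R} (hf : f ∈ LPA R E) {g : GraphGroupoid E}
    (hg : f g ≠ 0) : ∃ a b : ℕ, ∀ t : ℕ, ∀ y ∈ (g.source.take (b + t)).cylinder,
      ∃ h : GraphGroupoid E, f h ≠ 0 ∧ h.source = y ∧ h.range ∈ (g.range.take (a + t)).cylinder := by
  obtain ⟨a, b, hab, htail⟩ := g.shift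
  obtain ⟨N, hN⟩ := locally_const hf g
  refine ⟨a + (N + 1), b + (N + 1), fun t y hy => ?_⟩
  rw [InfPath.mem_take_iff] at hy
  obtain ⟨p, hp⟩ : ∃ p, a + (N + 1) + t = p + 1 := ⟨a + N + t, by omega⟩
  obtain ⟨q, hq⟩ : ∃ q, b + (N + 1) + t = q + 1 := ⟨b + N + t, by omega⟩
  rw [hp]
  rw [hq] at hy
  let z : InfPath E :=
    { edge := fun i => if i < p + 1 then g.range.edge i else y.edge (q + 1 + (i - (p + 1)))
      chain := by
        intro i
        rcases lt_trichotomy i p with hi | hi | hi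
        · rw [if_pos (by omega), if_pos (by omega)]
          exact g.range.chain i
        · subst hi
          rw [if_pos (by omega), if_neg (by omega), g.range.chain, Nat.sub_self, add_zero,
            ← y.chain, hy.2 q (by omega), g.source.chain,
            show i + 1 = a + (N + 1 + t) by omega, htail,
            show b + (N + 1 + t) = q + 1 by omega]
        · rw [if_neg (by omega), if_neg (by omega), y.chain]
          congr 2
          omega }
  have hz1 : ∀ i < p + 1, z.edge i = g.range.edge i := fun i hi => if_pos hi
  have hz2 : ∀ i, z.edge (p + 1 + i) = y.edge (q + 1 + i) := fun i => by
    simp only [z]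
    rw [if_neg (by omega)]
    congr 2
    omega
  have hz3 : z ∈ (g.range.take (p + 1)).cylinder := by
    rw [InfPath.mem_take_iff]
    exact ⟨congrArg E.r (hz1 0 (by omega)), hz1⟩
  refine ⟨⟨z, g.lag, y, p + 1, q + 1, by omega, hz2⟩, ?_, rfl, hz3⟩
  have hlag : g.lag = ((p + 1 : ℕ) : ℤ) - (q + 1 : ℕ) := by omega
  have hfg := hN (p + 1) (q + 1) (by omega) (by omega)
    ⟨z, g.lag, y, p + 1, q + 1, hlag, hz2⟩ ⟨hz3, ?_, hlag, hz2⟩ rfl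
  · rw [hfg]
    exact hg
  · rw [InfPath.mem_take_iff]
    exact hy

lemma alpha_cont {n : LPA R E} (hn : n ∈ normalizers R E) {x : InfPath E} (hx : x ∈ dom n)
    {V : Set (InfPath E)} (hV : IsOpen V) (hxV : alpha n x ∈ V) :
    ∃ U : Set (InfPath E), IsOpen U ∧ x ∈ U ∧ U ⊆ dom n ∧ ∀ y ∈ U, alpha n y ∈ V := by
  obtain ⟨g, hg, rfl⟩ := (mem_dom hn).1 hx
  rw [alpha_eq hn hg] at hxV
  obtain ⟨k, hk⟩ := exists_take_subset hV hxV
  obtain ⟨a, b, h⟩ := exists_section n.2 hg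
  refine ⟨(g.source.take (b + k)).cylinder, isOpen_cylinder _, InfPath.mem_cylinder_take _ _,
    fun y hy => ?_, fun y hy => ?_⟩
  · obtain ⟨h, h1, h2, -⟩ := h k y hy
    exact (mem_dom hn).2 ⟨h, h1, h2⟩
  · obtain ⟨h, h1, rfl, h3⟩ := h k y hy
    rw [alpha_eq hn h1]
    exact hk _ (by omega) h3

lemma isOpen_dom {n : LPA R E} (hn : n ∈ normalizers R E) : IsOpen (dom n) := by
  rw [isOpen_iff_forall_mem_open]
  intro x hx
  obtain ⟨U, h1, h2, h3, -⟩ := alpha_cont hn hx isOpen_univ trivial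
  exact ⟨U, h3, h1, h2⟩

lemma alpha_mem {n : LPA R E} (hn : n ∈ normalizers R E) {x : InfPath E} (hx : x ∈ dom n) :
    alpha n x ∈ dom (star n) ∧ alpha (star n) (alpha n x) = x := by
  obtain ⟨g, hg, rfl⟩ := (mem_dom hn).1 hx
  rw [alpha_eq hn hg]
  exact ⟨(mem_dom (star_mem_normalizers hn)).2 ⟨g.inv, inv_ne hg, rfl⟩,
    alpha_eq (star_mem_normalizers hn) (inv_ne hg)⟩

lemma isIsolated_of_alpha {n : LPA R E} (hn : n ∈ normalizers R E) {x : InfPath E}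
    (hx : x ∈ dom n) (h : IsIsolated x) : IsIsolated (alpha n x) := by
  obtain ⟨h1, h2⟩ := alpha_mem hn hx
  obtain ⟨U, hU, hxU, hUd, hUα⟩ := alpha_cont (star_mem_normalizers hn) h1 h (by rw [h2]; rfl)
  have : U = {alpha n x} := by
    refine Set.eq_singleton_iff_unique_mem.2 ⟨hxU, fun y hy => ?_⟩
    have h3 := (alpha_mem (star_mem_normalizers hn) (hUd hy)).2
    have h4 : alpha (star n) y = x := hUα y hy
    rw [star_star, h4] at h3
    exact h3.symm
  rw [IsIsolated, ← this]
  exact hU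

lemma isIsolated_alpha_iff {n : LPA R E} (hn : n ∈ normalizers R E) {x : InfPath E}
    (hx : x ∈ dom n) : IsIsolated (alpha n x) ↔ IsIsolated x := by
  refine ⟨fun h => ?_, isIsolated_of_alpha hn hx⟩
  obtain ⟨h1, h2⟩ := alpha_mem hn hx
  have := isIsolated_of_alpha (star_mem_normalizers hn) h1 h
  rwa [h2] at this

/-- At an isolated path, the relation says that the groupoid elements over the path agree. -/
lemma isolated_iff {n m : LPA R E} (hn : n ∈ normalizers R E) (hm : m ∈ normalizers R E)
    {x : InfPath E} (hxn : x ∈ dom n) (hxm : x ∈ dom m) :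
    (alpha n x = alpha m x ∧
        IsHomogeneous (conv (conv (pointFun R x) (star n * m).1) (pointFun R x)) 0) ↔
      ∃ g : GraphGroupoid E, n.1 g ≠ 0 ∧ m.1 g ≠ 0 ∧ g.source = x := by
  have hu : ∀ g : GraphGroupoid E, pointFun R x g ≠ 0 → g = unit g.source := by
    intro g hg
    have : g ∈ ({unit x} : Set (GraphGroupoid E)) := by
      by_contra hc
      exact hg (by simp [pointFun, charFun, Set.indicator_of_notMem hc])
    rw [Set.mem_singleton_iff.1 this]
    rfl
  have hp : pointFun R x (unit x) = 1 := by simp [pointFun, charFun]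
  constructor
  · rintro ⟨h1, h2⟩
    obtain ⟨a, ha, rfl⟩ := (mem_dom hn).1 hxn
    obtain ⟨b, hb, hab⟩ := (mem_dom hm).1 hxm
    have h3 : alpha m a.source = b.range := by rw [← hab, alpha_eq hm hb]
    rw [alpha_eq hn ha, h3] at h1
    have h4 : (star n * m).1 (a.inv.comp b h1) ≠ 0 :=
      comp_ne (star_mem_normalizers hn) (inv_ne ha) hb h1
    have h5 := h2 (a.inv.comp b h1) (by
      rw [conv_unit _ _ hu, unit_conv _ _ hu]
      have e1 : unit (a.inv.comp b h1).range = unit a.source := rfl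
      have e2 : unit (a.inv.comp b h1).source = unit a.source := congrArg unit hab
      rw [e1, e2, hp, one_mul, mul_one]
      exact h4)
    have : a = b := GraphGroupoid.ext h1 (by simp only [comp, inv] at h5; omega) hab.symm
    subst this
    exact ⟨a, ha, hb, rfl⟩
  · rintro ⟨a, ha, hb, rfl⟩
    refine ⟨(alpha_eq hn ha).trans (alpha_eq hm hb).symm, fun g hg => ?_⟩
    rw [conv_unit _ _ hu, unit_conv _ _ hu] at hg
    have hs : g.source = a.source := by
      by_contra hc
      refine right_ne_zero_of_mul hg ?_
      have : unit g.source ∉ ({unit a.source} : Set (GraphGroupoid E)) :=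
        fun h => hc (GraphGroupoid.ext_iff.1 (Set.mem_singleton_iff.1 h)).2.2
      simp [pointFun, charFun, Set.indicator_of_notMem this]
    have hr : g.range = a.source := by
      by_contra hc
      refine left_ne_zero_of_mul (left_ne_zero_of_mul hg) ?_
      have : unit g.range ∉ ({unit a.source} : Set (GraphGroupoid E)) :=
        fun h => hc (GraphGroupoid.ext_iff.1 (Set.mem_singleton_iff.1 h)).2.2
      simp [pointFun, charFun, Set.indicator_of_notMem this]
    obtain ⟨η, ζ, hh, rfl, h1, h2⟩ := exists_of_conv_ne
      (right_ne_zero_of_mul (left_ne_zero_of_mul hg))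
    have e1 : η.inv = a := supp_source_inj hn (star_ne.1 h1) ha hr
    have e2 : ζ = a := supp_source_inj hm h2 hb hs
    subst e1
    subst e2
    simp [comp, inv]

lemma WeylRel.of_isolated {p q : WeylPair R E} (hx : p.x = q.x) (hi : IsIsolated p.x)
    {g : GraphGroupoid E} (h1 : p.n.1 g ≠ 0) (h2 : q.n.1 g ≠ 0) (h3 : g.source = p.x) :
    WeylRel p q :=
  ⟨hx, Or.inl ⟨hi, (isolated_iff p.n_mem q.n_mem p.x_mem (hx ▸ q.x_mem)).2 ⟨g, h1, h2, h3⟩⟩⟩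

lemma WeylRel.exists_isolated {p q : WeylPair R E} (h : WeylRel p q) (hi : IsIsolated p.x) :
    ∃ g : GraphGroupoid E, p.n.1 g ≠ 0 ∧ q.n.1 g ≠ 0 ∧ g.source = p.x := by
  obtain ⟨hx, h | h⟩ := h
  · exact (isolated_iff p.n_mem q.n_mem p.x_mem (hx ▸ q.x_mem)).1 h.2
  · exact absurd hi h.1

lemma WeylRel.exists_nhds {p q : WeylPair R E} (h : WeylRel p q) (hi : ¬ IsIsolated p.x) :
    ∃ V : Set (InfPath E), IsOpen V ∧ p.x ∈ V ∧ V ⊆ dom p.n ∩ dom q.n ∧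
        ∀ y ∈ V, alpha p.n y = alpha q.n y := by
  obtain ⟨hx, h | h⟩ := h
  · exact absurd h.1 hi
  · exact h.2

/-- If the supports of `n` and `m` agree over a neighbourhood of `x`, then `(n, x) ∼ (m, x)`. -/
lemma WeylRel.of_nhds {p q : WeylPair R E} (hx : p.x = q.x) (U : Set (InfPath E)) (hU : IsOpen U)
    (hxU : p.x ∈ U) (h : ∀ y ∈ U, ∃ g : GraphGroupoid E, p.n.1 g ≠ 0 ∧ q.n.1 g ≠ 0 ∧ g.source = y) :
    WeylRel p q := by
  by_cases hi : IsIsolated p.x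
  · obtain ⟨g, h1, h2, h3⟩ := h _ hxU
    exact WeylRel.of_isolated hx hi h1 h2 h3
  · refine ⟨hx, Or.inr ⟨hi, U, hU, hxU, fun y hy => ?_, fun y hy => ?_⟩⟩
    · obtain ⟨g, h1, h2, rfl⟩ := h y hy
      exact ⟨(mem_dom p.n_mem).2 ⟨g, h1, rfl⟩, (mem_dom q.n_mem).2 ⟨g, h2, rfl⟩⟩
    · obtain ⟨g, h1, h2, rfl⟩ := h y hy
      rw [alpha_eq p.n_mem h1, alpha_eq q.n_mem h2]

lemma WeylRel.alpha_eq {p q : WeylPair R E} (h : WeylRel p q) :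
    alpha p.n p.x = alpha q.n q.x := by
  obtain ⟨hx, h | ⟨-, V, -, hxV, -, h⟩⟩ := h
  · rw [← hx]
    exact h.2.1
  · rw [← hx]
    exact h _ hxV

lemma WeylRel.refl (p : WeylPair R E) : WeylRel p p := by
  refine WeylRel.of_nhds rfl _ (isOpen_dom p.n_mem) p.x_mem fun y hy => ?_
  obtain ⟨g, hg, h⟩ := (mem_dom p.n_mem).1 hy
  exact ⟨g, hg, hg, h⟩

lemma WeylRel.symm {p q : WeylPair R E} (h : WeylRel p q) : WeylRel q p := by
  by_cases hi : IsIsolated p.x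
  · obtain ⟨g, h1, h2, h3⟩ := h.exists_isolated hi
    exact WeylRel.of_isolated h.1.symm (h.1 ▸ hi) h2 h1 (h3.trans h.1)
  · obtain ⟨V, h1, h2, h3, h4⟩ := h.exists_nhds hi
    exact ⟨h.1.symm, Or.inr ⟨h.1 ▸ hi, V, h1, h.1 ▸ h2, h3.trans (Set.inter_comm _ _).subset,
      fun y hy => (h4 y hy).symm⟩⟩

lemma WeylRel.trans {p q t : WeylPair R E} (h : WeylRel p q) (h' : WeylRel q t) :
    WeylRel p t := by
  by_cases hi : IsIsolated p.x
  · obtain ⟨g, h1, h2, h3⟩ := h.exists_isolated hi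
    obtain ⟨g', h1', h2', h3'⟩ := h'.exists_isolated (h.1 ▸ hi)
    have : g = g' := supp_source_inj q.n_mem h2 h1' (h3.trans (h.1.trans h3'.symm))
    subst this
    exact WeylRel.of_isolated (h.1.trans h'.1) hi h1 h2' h3
  · obtain ⟨V, h1, h2, h3, h4⟩ := h.exists_nhds hi
    obtain ⟨V', h1', h2', h3', h4'⟩ := h'.exists_nhds (h.1 ▸ hi)
    exact ⟨h.1.trans h'.1, Or.inr ⟨hi, V ∩ V', h1.inter h1', ⟨h2, h.1 ▸ h2'⟩,
      fun y hy => ⟨(h3 hy.1).1, (h3' hy.2).2⟩, fun y hy => (h4 y hy.1).trans (h4' y hy.2)⟩⟩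

end weyl

/-- The setoid of the relation `∼`. -/
instance weylSetoid (R : Type w) [CommRing R] [StarRing R] [IsDomain R]
    (E : DirectedGraph.{u, v}) : Setoid (WeylPair R E) where
  r := WeylRel
  iseqv := ⟨WeylRel.refl, WeylRel.symm, WeylRel.trans⟩

section weylOps

variable [StarRing R] [IsDomain R]

lemma alpha_mul {m n : LPA R E} (hm : m ∈ normalizers R E) (hn : n ∈ normalizers R E)
    {x : InfPath E} (hx : x ∈ dom n) (hx' : alpha n x ∈ dom m) :
    x ∈ dom (m * n) ∧ alpha (m * n) x = alpha m (alpha n x) := by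
  obtain ⟨b, hb, rfl⟩ := (mem_dom hn).1 hx
  rw [alpha_eq hn hb] at hx' ⊢
  obtain ⟨a, ha, hab⟩ := (mem_dom hm).1 hx'
  have h := comp_ne hm ha hb hab
  have hN := mul_mem_normalizers hm hn
  refine ⟨(mem_dom hN).2 ⟨_, h, rfl⟩, (alpha_eq hN h).trans ?_⟩
  rw [← hab, alpha_eq hm ha]
  rfl

namespace WeylPair

/-- The pair `(n₁n₂, x₂)`. -/
noncomputable def mul (p q : WeylPair R E) (h : alpha q.n q.x = p.x) : WeylPair R E where
  n := p.n * q.n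
  x := q.x
  n_mem := mul_mem_normalizers p.n_mem q.n_mem
  x_mem := (alpha_mul p.n_mem q.n_mem q.x_mem (h ▸ p.x_mem)).1

/-- The pair `(n*, αₙ(x))`. -/
noncomputable def inv (p : WeylPair R E) : WeylPair R E where
  n := star p.n
  x := alpha p.n p.x
  n_mem := star_mem_normalizers p.n_mem
  x_mem := (alpha_mem p.n_mem p.x_mem).1

lemma alpha_inv (p : WeylPair R E) : alpha p.inv.n p.inv.x = p.x :=
  (alpha_mem p.n_mem p.x_mem).2

/-- The pair `(n*n, x)`. -/
noncomputable def source (p : WeylPair R E) : WeylPair R E := p.inv.mul p rfl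

/-- The pair `(nn*, αₙ(x))`. -/
noncomputable def range (p : WeylPair R E) : WeylPair R E := p.mul p.inv p.alpha_inv

/-- The first component is supported on the units. -/
def IsUnitPair (p : WeylPair R E) : Prop := ∀ g, p.n.1 g ≠ 0 → g = unit g.source

lemma IsUnitPair.rel {p q : WeylPair R E} (hp : p.IsUnitPair) (hq : q.IsUnitPair)
    (h : p.x = q.x) : WeylRel p q := by
  refine WeylRel.of_nhds h (dom p.n ∩ dom q.n)
    ((isOpen_dom p.n_mem).inter (isOpen_dom q.n_mem)) ⟨p.x_mem, h ▸ q.x_mem⟩ fun y hy => ?_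
  obtain ⟨a, ha, h1⟩ := (mem_dom p.n_mem).1 hy.1
  obtain ⟨b, hb, h2⟩ := (mem_dom q.n_mem).1 hy.2
  have : a = b := by rw [hp a ha, hq b hb, h1, h2]
  subst this
  exact ⟨a, ha, hb, h1⟩

lemma isUnitPair_source (p : WeylPair R E) : p.source.IsUnitPair := by
  intro g hg
  obtain ⟨η, ζ, hh, rfl, h1, h2⟩ := exists_of_conv_ne hg
  have : η.inv = ζ := supp_range_inj p.n_mem (star_ne.1 h1) h2 hh
  subst this
  ext <;> simp [comp, unit, GraphGroupoid.inv]

lemma isUnitPair_range (p : WeylPair R E) : p.range.IsUnitPair := by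
  intro g hg
  obtain ⟨η, ζ, hh, rfl, h1, h2⟩ := exists_of_conv_ne hg
  have : ζ.inv = η := supp_source_inj p.n_mem (star_ne.1 h2) h1 hh.symm
  subst this
  ext <;> simp [comp, unit, GraphGroupoid.inv]

lemma IsUnitPair.alpha {p : WeylPair R E} (hp : p.IsUnitPair) : alpha p.n p.x = p.x := by
  obtain ⟨a, ha, h1⟩ := (mem_dom p.n_mem).1 p.x_mem
  rw [← h1, alpha_eq p.n_mem ha]
  exact congrArg GraphGroupoid.range (hp a ha)

lemma alpha_mul (p q : WeylPair R E) (h : DirectedGraph.alpha q.n q.x = p.x) :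
    DirectedGraph.alpha (p.mul q h).n (p.mul q h).x = DirectedGraph.alpha p.n p.x := by
  have := (DirectedGraph.alpha_mul p.n_mem q.n_mem q.x_mem (h ▸ p.x_mem)).2
  rw [h] at this
  exact this

lemma mul_congr {p p' q q' : WeylPair R E} (hp : WeylRel p p') (hq : WeylRel q q')
    (h : DirectedGraph.alpha q.n q.x = p.x) (h' : DirectedGraph.alpha q'.n q'.x = p'.x) :
    WeylRel (p.mul q h) (p'.mul q' h') := by
  by_cases hi : IsIsolated q.x
  · obtain ⟨b, hb, hb', hbx⟩ := hq.exists_isolated hi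
    have hi' : IsIsolated p.x := h ▸ isIsolated_of_alpha q.n_mem q.x_mem hi
    obtain ⟨a, ha, ha', hax⟩ := hp.exists_isolated hi'
    have hab : a.source = b.range := by rw [hax, ← h, ← hbx, alpha_eq q.n_mem hb]
    exact WeylRel.of_isolated (p := p.mul q h) (q := p'.mul q' h') hq.1 hi
      (comp_ne p.n_mem ha hb hab) (comp_ne p'.n_mem ha' hb' hab) hbx
  · have hi' : ¬ IsIsolated p.x := by
      rw [← h, isIsolated_alpha_iff q.n_mem q.x_mem]
      exact hi
    obtain ⟨Y, hY, hxY, hYd, hYα⟩ := hq.exists_nhds hi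
    obtain ⟨V, hV, hxV, hVd, hVα⟩ := hp.exists_nhds hi'
    obtain ⟨U, hU, hxU, hUd, hUα⟩ := alpha_cont q.n_mem q.x_mem hV (h ▸ hxV)
    refine ⟨hq.1, Or.inr ⟨hi, U ∩ Y, hU.inter hY, ⟨hxU, hxY⟩, fun y hy => ⟨?_, ?_⟩,
      fun y hy => ?_⟩⟩
    · exact (DirectedGraph.alpha_mul p.n_mem q.n_mem (hUd hy.1) (hVd (hUα y hy.1)).1).1
    · refine (DirectedGraph.alpha_mul p'.n_mem q'.n_mem (hYd hy.2).2 ?_).1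
      rw [← hYα y hy.2]
      exact (hVd (hUα y hy.1)).2
    · refine ((DirectedGraph.alpha_mul p.n_mem q.n_mem (hUd hy.1) (hVd (hUα y hy.1)).1).2).trans ?_
      refine Eq.trans ?_ (DirectedGraph.alpha_mul p'.n_mem q'.n_mem (hYd hy.2).2 ?_).2.symm
      · rw [← hYα y hy.2]
        exact hVα _ (hUα y hy.1)
      · rw [← hYα y hy.2]
        exact (hVd (hUα y hy.1)).2

lemma inv_congr {p q : WeylPair R E} (h : WeylRel p q) : WeylRel p.inv q.inv := by
  by_cases hi : IsIsolated p.x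
  · obtain ⟨a, ha, ha', hax⟩ := h.exists_isolated hi
    refine WeylRel.of_isolated (p := p.inv) (q := q.inv) h.alpha_eq
      (isIsolated_of_alpha p.n_mem p.x_mem hi) (inv_ne ha) (inv_ne ha') ?_
    change a.range = DirectedGraph.alpha p.n p.x
    rw [← hax, alpha_eq p.n_mem ha]
  · obtain ⟨V, hV, hxV, hVd, hVα⟩ := h.exists_nhds hi
    have hx := alpha_mem p.n_mem p.x_mem
    obtain ⟨U, hU, hxU, hUd, hUα⟩ := alpha_cont (star_mem_normalizers p.n_mem) hx.1 hV
      (hx.2.symm ▸ hxV)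
    have key : ∀ y ∈ U, y ∈ dom (star q.n) ∧
        DirectedGraph.alpha (star p.n) y = DirectedGraph.alpha (star q.n) y := by
      intro y hy
      have h1 := hUα y hy
      have h2 := (alpha_mem (star_mem_normalizers p.n_mem) (hUd hy)).2
      rw [star_star, hVα _ h1] at h2
      have h3 := alpha_mem q.n_mem (hVd h1).2
      rw [h2] at h3
      exact ⟨h3.1, h3.2.symm⟩
    exact ⟨h.alpha_eq, Or.inr ⟨fun hc => hi ((isIsolated_alpha_iff p.n_mem p.x_mem).1 hc),
      U, hU, hxU, fun y hy => ⟨hUd hy, (key y hy).1⟩, fun y hy => (key y hy).2⟩⟩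

lemma source_congr {p q : WeylPair R E} (h : WeylRel p q) : WeylRel p.source q.source :=
  p.isUnitPair_source.rel q.isUnitPair_source h.1

lemma range_congr {p q : WeylPair R E} (h : WeylRel p q) : WeylRel p.range q.range :=
  p.isUnitPair_range.rel q.isUnitPair_range h.alpha_eq

/-- Multiplying by a unit from the right does not change the class. -/
lemma mul_unit {p q : WeylPair R E} (hq : q.IsUnitPair) (h : DirectedGraph.alpha q.n q.x = p.x) :
    WeylRel (p.mul q h) p := by
  have hx : q.x = p.x := hq.alpha.symm.trans h
  refine WeylRel.of_nhds hx (dom p.n ∩ dom q.n)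
    ((isOpen_dom p.n_mem).inter (isOpen_dom q.n_mem)) ⟨hx.symm ▸ p.x_mem, q.x_mem⟩ fun y hy => ?_
  obtain ⟨a, ha, h1⟩ := (mem_dom p.n_mem).1 hy.1
  obtain ⟨b, hb, h2⟩ := (mem_dom q.n_mem).1 hy.2
  have hbu := hq b hb
  have hab : a.source = b.range := by rw [h1, ← h2, hbu]; rfl
  refine ⟨a, ?_, ha, h1⟩
  have := comp_ne p.n_mem ha hb hab
  have e : a.comp b hab = a := by
    refine GraphGroupoid.ext rfl ?_ (h2.trans h1.symm)
    have := congrArg GraphGroupoid.lag hbu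
    simp only [unit] at this
    simp [comp, this]
  rwa [e] at this

/-- Multiplying by a unit from the left does not change the class. -/
lemma unit_mul {p q : WeylPair R E} (hp : p.IsUnitPair) (h : DirectedGraph.alpha q.n q.x = p.x) :
    WeylRel (p.mul q h) q := by
  obtain ⟨U, hU, hxU, hUd, hUα⟩ := alpha_cont q.n_mem q.x_mem (isOpen_dom p.n_mem)
    (h ▸ p.x_mem)
  refine WeylRel.of_nhds rfl U hU hxU fun y hy => ?_
  obtain ⟨b, hb, h2⟩ := (mem_dom q.n_mem).1 (hUd hy)
  have h3 := hUα y hy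
  rw [← h2, alpha_eq q.n_mem hb] at h3
  obtain ⟨a, ha, hab⟩ := (mem_dom p.n_mem).1 h3
  have hau := hp a ha
  refine ⟨b, ?_, hb, h2⟩
  have := comp_ne p.n_mem ha hb hab
  have e : a.comp b hab = b := by
    have h4 := congrArg GraphGroupoid.lag hau
    have h5 : a.range = a.source := congrArg GraphGroupoid.range hau
    refine GraphGroupoid.ext (h5.trans hab) ?_ rfl
    simp only [unit] at h4
    simp [comp, h4]
  rwa [e] at this

end WeylPair

end weylOps

/-- The structure of an (algebraic) groupoid on the set `G` of morphisms: range and source maps with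
values in the unit space (the identity morphisms), a partially defined associative product `ab`,
defined if and only if the source of `a` is the range of `b`, and inverses. -/
class GroupoidStructure (G : Type w) where
  range : G → G
  source : G → G
  inv : G → G
  comp : ∀ a b : G, source a = range b → G
  range_range : ∀ a, range (range a) = range a
  source_range : ∀ a, source (range a) = range a
  range_source : ∀ a, range (source a) = source a
  source_source : ∀ a, source (source a) = source a
  range_comp : ∀ a b h, range (comp a b h) = range a
  source_comp : ∀ a b h, source (comp a b h) = source b
  comp_assoc : ∀ a b c (hab : source a = range b) (hbc : source b = range c),
    comp (comp a b hab) c ((source_comp a b hab).trans hbc) =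
      comp a (comp b c hbc) (hab.trans (range_comp b c hbc).symm)
  range_comp_self : ∀ a, comp (range a) a (source_range a) = a
  comp_source_self : ∀ a, comp a (source a) (range_source a).symm = a
  range_inv : ∀ a, range (inv a) = source a
  source_inv : ∀ a, source (inv a) = range a
  inv_comp : ∀ a, comp (inv a) a (source_inv a) = source a
  comp_inv : ∀ a, comp a (inv a) (range_inv a).symm = range a

/-- An isomorphism of topological groupoids: a homeomorphism that respects range, source and the
partially defined product. -/
structure TopGroupoidIso (G : Type v) (H : Type w) [TopologicalSpace G] [TopologicalSpace H]
    [GroupoidStructure G] [GroupoidStructure H] extends G ≃ₜ H where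
  map_range : ∀ a : G, toFun (GroupoidStructure.range a) = GroupoidStructure.range (toFun a)
  map_source : ∀ a : G, toFun (GroupoidStructure.source a) = GroupoidStructure.source (toFun a)
  map_comp : ∀ (a b : G) (h : GroupoidStructure.source a = GroupoidStructure.range b),
    toFun (GroupoidStructure.comp a b h) = GroupoidStructure.comp (toFun a) (toFun b)
      ((map_source a).symm.trans ((congrArg toFun h).trans (map_range b)))

/-- The algebraic Weyl groupoid `W_E`, as a set: the classes `[(n, x)]`. -/
def WeylGroupoid (R : Type w) [CommRing R] [StarRing R] [IsDomain R]
    (E : DirectedGraph.{u, v}) : Type (max v w) := Quotient (weylSetoid R E)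

namespace WeylGroupoid

variable [StarRing R] [IsDomain R]

/-- The class of a pair. -/
def ofPair (p : WeylPair R E) : WeylGroupoid R E := Quotient.mk (weylSetoid R E) p

/-- The class `[(n, x)]`, for `n ∈ N(E)` and `x ∈ dom(n)`. -/
def mk (n : LPA R E) (x : InfPath E) (hn : n ∈ normalizers R E) (hx : x ∈ dom n) :
    WeylGroupoid R E := ofPair ⟨n, x, hn, hx⟩

lemma ofPair_eq {p q : WeylPair R E} : ofPair p = ofPair q ↔ WeylRel p q :=
  ⟨fun h => Quotient.exact h, fun h => Quotient.sound h⟩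

/-- The source map `[(n, x)] ↦ [(n*n, x)]`. -/
noncomputable def source (a : WeylGroupoid R E) : WeylGroupoid R E :=
  Quotient.map WeylPair.source (fun _ _ h => WeylPair.source_congr h) a

/-- The range map `[(n, x)] ↦ [(nn*, αₙ(x))]`. -/
noncomputable def range (a : WeylGroupoid R E) : WeylGroupoid R E :=
  Quotient.map WeylPair.range (fun _ _ h => WeylPair.range_congr h) a

/-- The inverse `[(n, x)] ↦ [(n*, αₙ(x))]`. -/
noncomputable def inv (a : WeylGroupoid R E) : WeylGroupoid R E :=
  Quotient.map WeylPair.inv (fun _ _ h => WeylPair.inv_congr h) a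

lemma source_ofPair (p : WeylPair R E) : source (ofPair p) = ofPair p.source := rfl

lemma range_ofPair (p : WeylPair R E) : range (ofPair p) = ofPair p.range := rfl

lemma inv_ofPair (p : WeylPair R E) : inv (ofPair p) = ofPair p.inv := rfl

/-- The classes `[(n₁, x₁)]` and `[(n₂, x₂)]` are composable if and only if `α_{n₂}(x₂) = x₁`. -/
lemma composable_iff (p q : WeylPair R E) :
    source (ofPair p) = range (ofPair q) ↔ alpha q.n q.x = p.x := by
  rw [source_ofPair, range_ofPair, ofPair_eq]
  exact ⟨fun h => h.1.symm, fun h => p.isUnitPair_source.rel q.isUnitPair_range h.symm⟩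

lemma ofPair_out (a : WeylGroupoid R E) : ofPair (Quotient.out a) = a := Quotient.out_eq a

lemma composable_out {a b : WeylGroupoid R E} (h : source a = range b) :
    alpha (Quotient.out b).n (Quotient.out b).x = (Quotient.out a).x := by
  rw [← composable_iff, ofPair_out, ofPair_out]
  exact h

/-- The product; see `comp_ofPair`. -/
noncomputable def comp (a b : WeylGroupoid R E) (h : source a = range b) : WeylGroupoid R E :=
  ofPair (WeylPair.mul (Quotient.out a) (Quotient.out b) (composable_out h))

/-- The product is `[(n₁, x₁)][(n₂, x₂)] = [(n₁n₂, x₂)]`. -/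
lemma comp_ofPair (p q : WeylPair R E) (h : source (ofPair p) = range (ofPair q)) :
    comp (ofPair p) (ofPair q) h = ofPair (p.mul q ((composable_iff p q).1 h)) := by
  unfold comp
  rw [ofPair_eq]
  exact WeylPair.mul_congr (ofPair_eq.1 (ofPair_out _)) (ofPair_eq.1 (ofPair_out _)) _ _

noncomputable instance : GroupoidStructure (WeylGroupoid R E) where
  range := range
  source := source
  inv := inv
  comp := comp
  range_range := by
    rintro ⟨p⟩
    exact ofPair_eq.2 (p.range.isUnitPair_range.rel p.isUnitPair_range p.isUnitPair_range.alpha)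
  source_range := by
    rintro ⟨p⟩
    exact ofPair_eq.2 (p.range.isUnitPair_source.rel p.isUnitPair_range rfl)
  range_source := by
    rintro ⟨p⟩
    exact ofPair_eq.2 (p.source.isUnitPair_range.rel p.isUnitPair_source p.isUnitPair_source.alpha)
  source_source := by
    rintro ⟨p⟩
    exact ofPair_eq.2 (p.source.isUnitPair_source.rel p.isUnitPair_source rfl)
  range_comp := by
    rintro ⟨p⟩ ⟨q⟩ h
    refine (congrArg range (comp_ofPair p q h)).trans (ofPair_eq.2 ?_)
    exact (WeylPair.isUnitPair_range _).rel p.isUnitPair_range (WeylPair.alpha_mul _ _ _)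
  source_comp := by
    rintro ⟨p⟩ ⟨q⟩ h
    refine (congrArg source (comp_ofPair p q h)).trans (ofPair_eq.2 ?_)
    exact (WeylPair.isUnitPair_source _).rel q.isUnitPair_source rfl
  comp_assoc := by
    rintro ⟨p⟩ ⟨q⟩ ⟨t⟩ hab hbc
    have h1 := comp_ofPair p q hab
    have h2 := comp_ofPair q t hbc
    change comp (comp (ofPair p) (ofPair q) hab) (ofPair t) _ =
      comp (ofPair p) (comp (ofPair q) (ofPair t) hbc) _
    simp only [h1, h2, comp_ofPair]
    congr 1
    simp only [WeylPair.mul, mul_assoc]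
  range_comp_self := by
    rintro ⟨p⟩
    refine (comp_ofPair p.range p _).trans (ofPair_eq.2 ?_)
    exact WeylPair.unit_mul p.isUnitPair_range _
  comp_source_self := by
    rintro ⟨p⟩
    refine (comp_ofPair p p.source _).trans (ofPair_eq.2 ?_)
    exact WeylPair.mul_unit p.isUnitPair_source _
  range_inv := by
    rintro ⟨p⟩
    exact ofPair_eq.2 (p.inv.isUnitPair_range.rel p.isUnitPair_source p.alpha_inv)
  source_inv := by
    rintro ⟨p⟩
    exact ofPair_eq.2 (p.inv.isUnitPair_source.rel p.isUnitPair_range rfl)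
  inv_comp := by
    rintro ⟨p⟩
    exact comp_ofPair p.inv p _
  comp_inv := by
    rintro ⟨p⟩
    exact comp_ofPair p p.inv _

/-- The basic open set `Z(n) = {[(n, x)] : x ∈ dom(n)}`. -/
def basicSet (n : LPA R E) (hn : n ∈ normalizers R E) : Set (WeylGroupoid R E) :=
  {a | ∃ (x : InfPath E) (hx : x ∈ dom n), a = mk n x hn hx}

/-- The topology of `W_E`, generated by the sets `Z(n)` with `n ∈ N(E)`. -/
instance : TopologicalSpace (WeylGroupoid R E) :=
  TopologicalSpace.generateFrom {U | ∃ (n : LPA R E) (hn : n ∈ normalizers R E), U = basicSet n hn}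

end WeylGroupoid

section compactOpen

lemma rInj_units (A : Set (InfPath E)) : RInj (unit '' A) := by
  rintro _ ⟨x, -, rfl⟩ _ ⟨y, -, rfl⟩ h
  exact congrArg unit h

lemma mulSet_units (A B : Set (InfPath E)) : mulSet (unit '' A) (unit '' B) = unit '' (A ∩ B) := by
  ext g
  constructor
  · rintro ⟨_, ⟨x, hx, rfl⟩, _, ⟨y, hy, rfl⟩, h, rfl⟩
    obtain rfl : x = y := h
    exact ⟨x, ⟨hx, hy⟩, by ext <;> simp [unit, comp]⟩
  · rintro ⟨x, ⟨hx, hy⟩, rfl⟩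
    exact ⟨_, ⟨x, hx, rfl⟩, _, ⟨x, hy, rfl⟩, rfl, by ext <;> simp [unit, comp]⟩

lemma units_cylinder (μ : FinPath E) : unit '' μ.cylinder = Z μ μ := by
  ext g
  constructor
  · rintro ⟨x, hx, rfl⟩
    exact unit_mem_Z.2 hx
  · intro h
    exact ⟨g.source, h.2.1, (unit_of_mem_Z h).symm⟩

lemma char_biUnion_mem (t : Finset (InfPath E)) (k : InfPath E → ℕ) :
    charFun R (unit '' ⋃ x ∈ t, (x.take (k x)).cylinder) ∈ LPA R E := by
  classical
  induction t using Finset.induction_on with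
  | empty =>
    simp only [Finset.notMem_empty, Set.iUnion_of_empty, Set.iUnion_empty, Set.image_empty,
      char_empty]
    exact zero_mem _
  | insert a t _ ih =>
    rw [Finset.set_biUnion_insert]
    have h1 : charFun R (unit '' (a.take (k a)).cylinder) ∈ LPA R E := by
      rw [units_cylinder]
      exact char_Z_mem _ _
    have h2 := conv_mem h1 ih
    rw [conv_char_char (rInj_units _), mulSet_units] at h2
    have h3 : ∀ A B : Set (InfPath E), charFun R (unit '' (A ∪ B)) =
        charFun R (unit '' A) + charFun R (unit '' B) - charFun R (unit '' (A ∩ B)) := by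
      intro A B
      rw [Set.image_union, Set.image_inter (fun x y h => congrArg GraphGroupoid.source h)]
      funext g
      simp only [charFun, Pi.add_apply, Pi.sub_apply, Set.indicator_apply, Set.mem_union,
        Set.mem_inter_iff]
      by_cases hA : g ∈ unit '' A <;> by_cases hB : g ∈ unit '' B <;> simp [hA, hB]
    rw [h3]
    exact sub_mem (add_mem h1 ih) h2

lemma char_compactOpen_mem {L : Set (InfPath E)} (hc : IsCompact L) (ho : IsOpen L) :
    charFun R (unit '' L) ∈ LPA R E := by
  choose! k hk using fun x (hx : x ∈ L) => exists_take_subset ho hx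
  obtain ⟨t, ht, hL⟩ := hc.elim_nhds_subcover (fun x => (x.take (k x)).cylinder)
    fun x _ => (isOpen_cylinder _).mem_nhds (InfPath.mem_cylinder_take _ _)
  have : L = ⋃ x ∈ t, (x.take (k x)).cylinder :=
    hL.antisymm (Set.iUnion₂_subset fun x hx => hk x (ht x hx) _ le_rfl)
  rw [this]
  exact char_biUnion_mem t k

end compactOpen

/-- The element `1_L` of `L_R(E)`, for a compact open set `L` of infinite paths, which is regarded as
a subset of the unit space of `G_E`. -/
noncomputable def LPA.one (R : Type w) [CommRing R] {L : Set (InfPath E)} (hc : IsCompact L)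
    (ho : IsOpen L) : LPA R E := ⟨charFun R (unit '' L), char_compactOpen_mem hc ho⟩

/-- The map `κ : E^∞ → F^∞` is induced by `π : L_R(E) → L_R(F)`: for every compact open subset `L`
of `E^∞`, one has `x ∈ L` if and only if `κ(x) ∈ supp(π(1_L))`. -/
def IsInduced {E : DirectedGraph.{u₁, v₁}} {F : DirectedGraph.{u₂, v₂}} (π : LPA R E → LPA R F)
    (κ : InfPath E → InfPath F) : Prop :=
  ∀ (L : Set (InfPath E)) (hc : IsCompact L) (ho : IsOpen L) (x : InfPath E),
    x ∈ L ↔ (π (LPA.one R hc ho)).1 (unit (κ x)) ≠ 0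

end DirectedGraph

/-! Everything that enters the Weyl groupoid can be recovered from the `*`-ring together with its
diagonal, and an isomorphism preserving both must therefore carry one Weyl groupoid to the other.

The space comes from Stone duality. Row-finiteness makes cylinders compact (`isCompact_cylinder`),
so the path space is Hausdorff with a base of compact open sets. Since `R` is a domain, the
idempotents of the diagonal are exactly the functions `1_L` with `L` compact open
(`eq_one_of_idem`). Hence π induces an isomorphism of the Boolean rings of compact open sets, and κ
is the dual homeomorphism (`MapsDiagonal.exists_point`, `MapsDiagonal.exists_homeomorph`); it is
unique because compact open sets separate points.

As π need not be `R`-linear, the values of a diagonal element are not transported, but its support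
is: `d` vanishes at `x` if and only if `d * 1_L = 0` for some compact open `L` containing `x`
(`IsDiagonalIso.map_ne_iff`).

The partial action is visible through supports as well: `x ∈ supp(n* 1_L n)` if and only if `x ∈
dom(n)` and `αₙ(x) ∈ L` (`sandwich_ne_iff`). Thus κ intertwines `αₙ` with the action of `π(n)`
(`IsDiagonalIso.map_mem_dom`), which settles the relation at paths that are not isolated. At an
isolated path, degrees occur, and π need not respect the grading. There `1_{x}` lies in the
diagonal, and the corner element `1_{x} n* m 1_{x}` has degree 0 exactly when it is in the diagonal
(`isHomogeneous_iff_mem_diag`), a condition that π preserves.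

The map Ψ is then well defined, respects the operations because π is multiplicative and commutes
with `*`, pulls `Z(m)` back to `Z(π⁻¹(m))`, and is inverted by the map built from `π⁻¹`. -/

namespace DirectedGraph

open GraphGroupoid

/-! ### Topology of the infinite-path space -/

section PathSpace

variable {E : DirectedGraph.{u, v}}

lemma InfPath.eq_of_forall_mem_take {x y : InfPath E} (h : ∀ n, y ∈ (x.take n).cylinder) :
    y = x :=
  InfPath.ext (funext fun i => ((x.mem_take_iff y (i + 1)).1 (h (i + 1))).2 i (Nat.lt_succ_self i))

/-- Cylinders of initial segments of equal length are either equal or disjoint, so a length at which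
two paths are told apart separates them. -/
instance : T2Space (InfPath E) := by
  refine ⟨fun x y hxy => ?_⟩
  obtain ⟨n, hn⟩ : ∃ n, y ∉ (x.take n).cylinder := by
    by_contra! h
    exact hxy (InfPath.eq_of_forall_mem_take h).symm
  refine ⟨_, _, isOpen_cylinder _,
    isOpen_cylinder _, x.mem_cylinder_take n,
    y.mem_cylinder_take n, Set.disjoint_left.2 fun z hx hy => hn ?_⟩
  rw [InfPath.mem_take_iff] at hx hy ⊢
  exact ⟨hy.1.symm.trans hx.1, fun i hi => (hy.2 i hi).symm.trans (hx.2 i hi)⟩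

/-- The infinite-path space carries the topology of the product of discrete edge sets. -/
lemma InfPath.isInducing_edge [TopologicalSpace E.Edge] [DiscreteTopology E.Edge] :
    Topology.IsInducing (InfPath.edge : InfPath E → ℕ → E.Edge) := by
  refine ⟨le_antisymm ?_ (le_generateFrom ?_)⟩
  · refine continuous_iff_le_induced.1 (continuous_pi fun i => continuous_def.2 fun s _ => ?_)
    rw [isOpen_iff_forall_mem_open]
    refine fun x hx => ⟨(x.take (i + 1)).cylinder, fun y hy => ?_,
      isOpen_cylinder _, x.mem_cylinder_take _⟩
    have := ((x.mem_take_iff y (i + 1)).1 hy).2 i (Nat.lt_succ_self i)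
    rw [Set.mem_preimage] at hx ⊢
    rwa [this]
  · rintro _ ⟨μ, rfl⟩
    rw [isOpen_induced_iff]
    -- The condition on the range is needed on its own: when `μ` is a vertex it is the only
    -- condition.
    refine ⟨{f | E.r (f 0) = μ.range} ∩ ⋂ i : Fin μ.length, {f | f i = μ.edge i}, ?_, ?_⟩
    · refine IsOpen.inter ?_ (isOpen_iInter_of_finite fun i => ?_)
      · exact (isOpen_discrete {e : E.Edge | E.r e = μ.range}).preimage
          (continuous_apply 0 : Continuous fun f : ℕ → E.Edge => f 0)
      · exact (isOpen_discrete {μ.edge i}).preimage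
          (continuous_apply (i : ℕ) : Continuous fun f : ℕ → E.Edge => f i)
    · ext x
      simp [FinPath.cylinder, InfPath.range]

/-- The edges that can occur in position `n` of a path with range `v`. -/
def edgesAt (E : DirectedGraph.{u, v}) (v : E.Vertex) : ℕ → Set E.Edge
  | 0 => {e | E.r e = v}
  | n + 1 => ⋃ f ∈ edgesAt E v n, {e | E.r e = E.s f}

lemma finite_edgesAt (hE : E.RowFinite) (v : E.Vertex) (n : ℕ) : (edgesAt E v n).Finite := by
  induction n with
  | zero => exact hE v
  | succ n ih => exact ih.biUnion fun f _ => hE (E.s f)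

lemma InfPath.edge_mem_edgesAt (x : InfPath E) (n : ℕ) : x.edge n ∈ edgesAt E x.range n := by
  induction n with
  | zero => exact rfl
  | succ n ih => exact Set.mem_biUnion ih (x.chain n).symm

/-- Tychonoff: with discrete edges, a cylinder is a closed subset of a product of finite sets,
because from a fixed range only finitely many edges can occur in each position. -/
lemma isCompact_cylinder (hE : E.RowFinite) (μ : FinPath E) : IsCompact μ.cylinder := by
  let _ : TopologicalSpace E.Edge := ⊥
  have : DiscreteTopology E.Edge := ⟨rfl⟩
  rw [InfPath.isInducing_edge.isCompact_iff]
  have hK : IsCompact (Set.univ.pi (edgesAt E μ.range)) :=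
    isCompact_univ_pi fun n => (finite_edgesAt hE _ n).isCompact
  refine hK.of_isClosed_subset ?_ ?_
  · have : InfPath.edge '' μ.cylinder = {f : ℕ → E.Edge | E.r (f 0) = μ.range} ∩
        ((⋂ i : Fin μ.length, {f | f i = μ.edge i}) ∩
          ⋂ i : ℕ, {f | E.s (f i) = E.r (f (i + 1))}) := by
      ext f
      simp only [Set.mem_image, Set.mem_inter_iff, Set.mem_iInter, Set.mem_ofPred_eq]
      constructor
      · rintro ⟨x, hx, rfl⟩
        exact ⟨hx.1, hx.2, x.chain⟩
      · rintro ⟨h1, h2, h3⟩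
        exact ⟨⟨f, h3⟩, ⟨h1, h2⟩, rfl⟩
    rw [this]
    refine IsClosed.inter ?_ ((isClosed_iInter fun i => ?_).inter (isClosed_iInter fun i => ?_))
    · exact (isClosed_discrete {e : E.Edge | E.r e = μ.range}).preimage
          (continuous_apply 0 : Continuous fun f : ℕ → E.Edge => f 0)
    · exact (isClosed_discrete {μ.edge i}).preimage
          (continuous_apply (i : ℕ) : Continuous fun f : ℕ → E.Edge => f i)
    · exact (isClosed_discrete {p : E.Edge × E.Edge | E.s p.1 = E.r p.2}).preimage
        ((continuous_apply i).prodMk (continuous_apply (i + 1)) :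
          Continuous fun f : ℕ → E.Edge => (f i, f (i + 1)))
  · rintro _ ⟨x, hx, rfl⟩ n -
    have := x.edge_mem_edgesAt n
    rwa [hx.1] at this

/-- Compact open sets separate infinite paths. -/
lemma InfPath.eq_of_compactOpen (hE : E.RowFinite) {x y : InfPath E}
    (h : ∀ L : Set (InfPath E), IsCompact L → IsOpen L → x ∈ L → y ∈ L) : y = x :=
  InfPath.eq_of_forall_mem_take fun n => h _ (isCompact_cylinder hE _)
    (isOpen_cylinder _) (x.mem_cylinder_take n)

/-- Cylinders that meet are nested, like balls in an ultrametric space. This is what closes the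
diagonal under products. -/
lemma FinPath.cylinder_inter_of_le {μ ν : FinPath E} (h : μ.length ≤ ν.length) {z : InfPath E}
    (hμ : z ∈ μ.cylinder) (hν : z ∈ ν.cylinder) : μ.cylinder ∩ ν.cylinder = ν.cylinder := by
  refine Set.inter_eq_right.2 fun y hy => ⟨?_, fun i => ?_⟩
  · rw [hy.1, ← hν.1, hμ.1]
  · have h1 := hy.2 ⟨i, i.2.trans_le h⟩
    have h2 := hν.2 ⟨i, i.2.trans_le h⟩
    exact (h1.trans h2.symm).trans (hμ.2 i)

end PathSpace

/-! ### The diagonal as an algebra of functions on the unit space -/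

section Diagonal

variable {R : Type w} [CommRing R] {E : DirectedGraph.{u, v}}

/-- A diagonal element is supported on units, so convolution with it only rescales values. In
particular the diagonal multiplies pointwise. -/
lemma diag_mul_apply {d : LPA R E} (hd : d ∈ diagonal R E) (f : LPA R E) (γ : GraphGroupoid E) :
    (d * f).1 γ = d.1 (unit γ.range) * f.1 γ :=
  unit_conv _ _ (fun _ hg => diag_unit hd hg) γ

lemma mul_diag_apply {d : LPA R E} (hd : d ∈ diagonal R E) (f : LPA R E) (γ : GraphGroupoid E) :
    (f * d).1 γ = f.1 γ * d.1 (unit γ.source) :=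
  conv_unit _ _ (fun _ hg => diag_unit hd hg) γ

lemma diag_mul_unit {d : LPA R E} (hd : d ∈ diagonal R E) (f : LPA R E) (x : InfPath E) :
    (d * f).1 (unit x) = d.1 (unit x) * f.1 (unit x) :=
  diag_mul_apply hd f (unit x)

lemma diag_ext {d d' : LPA R E} (hd : d ∈ diagonal R E) (hd' : d' ∈ diagonal R E)
    (h : ∀ x, d.1 (unit x) = d'.1 (unit x)) : d = d' := by
  refine Subtype.ext (funext fun g => ?_)
  by_cases h1 : d.1 g = 0
  · by_cases h2 : d'.1 g = 0
    · rw [h1, h2]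
    · rw [diag_unit hd' h2]
      exact h _
  · rw [diag_unit hd h1]
    exact h _

lemma LPA.coe_char (μ : FinPath E) :
    (LPA.char R μ μ).1 = charFun R (unit '' μ.cylinder) := by
  rw [units_cylinder]
  rfl

lemma char_mul_char_mem_diag (μ ν : FinPath E) :
    LPA.char R μ μ * LPA.char R ν ν ∈ diagonal R E := by
  have key : (LPA.char R μ μ * LPA.char R ν ν).1 =
      charFun R (unit '' (μ.cylinder ∩ ν.cylinder)) := by
    rw [coe_mul, LPA.coe_char, LPA.coe_char, conv_char_char (rInj_units _), mulSet_units]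
  rcases Set.eq_empty_or_nonempty (μ.cylinder ∩ ν.cylinder) with h | ⟨z, hz⟩
  · have : LPA.char R μ μ * LPA.char R ν ν = 0 := Subtype.ext (by
      rw [key, h, Set.image_empty, char_empty]
      rfl)
    rw [this]
    exact zero_mem _
  · rcases le_total μ.length ν.length with hl | hl
    · have : LPA.char R μ μ * LPA.char R ν ν = LPA.char R ν ν := Subtype.ext (by
        rw [key, FinPath.cylinder_inter_of_le hl hz.1 hz.2, units_cylinder]
        rfl)
      rw [this]
      exact char_mem_diag ν
    · have : LPA.char R μ μ * LPA.char R ν ν = LPA.char R μ μ := Subtype.ext (by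
        rw [key, Set.inter_comm, FinPath.cylinder_inter_of_le hl hz.2 hz.1, units_cylinder]
        rfl)
      rw [this]
      exact char_mem_diag μ

lemma smul_mul_LPA (c : R) (f g : LPA R E) : c • f * g = c • (f * g) :=
  Subtype.ext (smul_conv (rFin_of_mem f.2) c g.1)

lemma mul_smul_LPA (c : R) (f g : LPA R E) : f * c • g = c • (f * g) :=
  Subtype.ext (conv_smul (rFin_of_mem f.2) c g.1)

lemma mul_mem_diag {d d' : LPA R E} (hd : d ∈ diagonal R E) (hd' : d' ∈ diagonal R E) :
    d * d' ∈ diagonal R E := by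
  induction hd using Submodule.span_induction with
  | mem x h =>
    obtain ⟨μ, rfl⟩ := h
    induction hd' using Submodule.span_induction with
    | mem y h =>
      obtain ⟨ν, rfl⟩ := h
      exact char_mul_char_mem_diag μ ν
    | zero => rw [mul_zero]; exact zero_mem _
    | add y z _ _ hy hz => rw [mul_add]; exact add_mem hy hz
    | smul c y _ hy => rw [mul_smul_LPA]; exact Submodule.smul_mem _ _ hy
  | zero => rw [zero_mul]; exact zero_mem _
  | add y z _ _ hy hz => rw [add_mul]; exact add_mem hy hz
  | smul c y _ hy => rw [smul_mul_LPA]; exact Submodule.smul_mem _ _ hy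

open Classical in
lemma LPA.one_apply {L : Set (InfPath E)} (hc : IsCompact L) (ho : IsOpen L) (x : InfPath E) :
    (LPA.one R hc ho).1 (unit x) = if x ∈ L then 1 else 0 := by
  have : unit x ∈ unit '' L ↔ x ∈ L :=
    by
    refine ⟨?_, fun h => ⟨x, h, rfl⟩⟩
    rintro ⟨y, hy, h⟩
    obtain rfl : y = x := congrArg GraphGroupoid.source h
    exact hy
  simp only [LPA.one, charFun, Set.indicator_apply, this]

lemma LPA.one_apply_ne [Nontrivial R] {L : Set (InfPath E)} (hc : IsCompact L) (ho : IsOpen L)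
    {x : InfPath E} : (LPA.one R hc ho).1 (unit x) ≠ 0 ↔ x ∈ L := by
  rw [LPA.one_apply]
  split_ifs with h <;> simp [h]

/-- Inclusion-exclusion, `1_{A ∪ B} = 1_A + 1_B - 1_A 1_B`, stays inside the diagonal since it is
closed under products. Every compact open set is a finite union of this kind. -/
lemma exists_diag_biUnion (t : Finset (InfPath E)) (k : InfPath E → ℕ) :
    ∃ d ∈ diagonal R E, d.1 = charFun R (unit '' ⋃ x ∈ t, (x.take (k x)).cylinder) := by
  classical
  induction t using Finset.induction_on with
  | empty => exact ⟨0, zero_mem _, by simp [char_empty]⟩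
  | insert a t _ ih =>
    obtain ⟨d, hd, h⟩ := ih
    have ha := char_mem_diag (R := R) (a.take (k a))
    refine ⟨_, sub_mem (add_mem ha hd) (mul_mem_diag ha hd), ?_⟩
    rw [Finset.set_biUnion_insert]
    change (LPA.char R (a.take (k a)) (a.take (k a))).1 + d.1 -
      conv (LPA.char R (a.take (k a)) (a.take (k a))).1 d.1 = _
    rw [h, LPA.coe_char, conv_char_char (rInj_units _), mulSet_units,
      Set.image_union, Set.image_inter (fun x y h => congrArg GraphGroupoid.source h)]
    funext g
    simp only [charFun, Pi.add_apply, Pi.sub_apply, Set.indicator_apply, Set.mem_union,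
      Set.mem_inter_iff]
    by_cases hA : g ∈ unit '' (a.take (k a)).cylinder <;>
      by_cases hB : g ∈ unit '' ⋃ x ∈ t, (x.take (k x)).cylinder <;> simp [hA, hB]

lemma LPA.one_mem_diag {L : Set (InfPath E)} (hc : IsCompact L)
    (ho : IsOpen L) : LPA.one R hc ho ∈ diagonal R E := by
  choose! k hk using fun x (hx : x ∈ L) => exists_take_subset ho hx
  obtain ⟨t, ht, hL⟩ := hc.elim_nhds_subcover (fun x => (x.take (k x)).cylinder)
    fun x _ => (isOpen_cylinder _).mem_nhds (InfPath.mem_cylinder_take _ _)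
  have : L = ⋃ x ∈ t, (x.take (k x)).cylinder :=
    hL.antisymm (Set.iUnion₂_subset fun x hx => hk x (ht x hx) _ le_rfl)
  obtain ⟨d, hd, h⟩ := exists_diag_biUnion (R := R) t k
  rw [← this] at h
  have : LPA.one R hc ho = d := Subtype.ext h.symm
  rwa [this]

end Diagonal

/-! ### Supports and idempotents of the diagonal -/

section Support

variable {R : Type w} [CommRing R] [IsDomain R] [StarRing R] {E : DirectedGraph.{u, v}}

/-- The support of the restriction of `d` to the unit space. -/
def unitSupport (d : LPA R E) : Set (InfPath E) := {x | d.1 (unit x) ≠ 0}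

lemma isLocallyConstant_unit (f : LPA R E) : IsLocallyConstant fun x => f.1 (unit x) := by
  rw [IsLocallyConstant.iff_exists_open]
  intro x
  obtain ⟨N, hN⟩ := locally_const f.2 (unit x)
  exact ⟨(x.take N).cylinder, isOpen_cylinder _, x.mem_cylinder_take N, fun y hy =>
    hN N N le_rfl le_rfl (unit y) (unit_mem_Z.2 hy) rfl⟩

lemma isOpen_unitSupport (f : LPA R E) : IsOpen (unitSupport f) :=
  isLocallyConstant_unit f {0}ᶜ

/-- A linear combination of cylinder functions lives on a finite union of compact cylinders, and its
support is closed by local constancy. -/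
lemma isCompact_unitSupport (hE : E.RowFinite) {d : LPA R E} (hd : d ∈ diagonal R E) :
    IsCompact (unitSupport d) := by
  obtain ⟨K, hK, h⟩ : ∃ K : Set (InfPath E), IsCompact K ∧ unitSupport d ⊆ K := by
    induction hd using Submodule.span_induction with
    | mem x h =>
      obtain ⟨μ, rfl⟩ := h
      refine ⟨_, isCompact_cylinder hE μ, fun x hx => ?_⟩
      by_contra hc
      have : unit x ∉ Z μ μ := fun h => hc (unit_mem_Z.1 h)
      exact hx (by simp [LPA.char, charFun, this])
    | zero => exact ⟨∅, isCompact_empty, fun x hx => hx rfl⟩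
    | add y z _ _ hy hz =>
      obtain ⟨K, hK, h⟩ := hy
      obtain ⟨K', hK', h'⟩ := hz
      refine ⟨K ∪ K', hK.union hK', fun x hx => ?_⟩
      by_cases hy0 : y.1 (unit x) = 0
      · exact Or.inr (h' fun hz0 => hx (by simp [hy0, hz0]))
      · exact Or.inl (h hy0)
    | smul c y _ hy =>
      obtain ⟨K, hK, h⟩ := hy
      exact ⟨K, hK, fun x hx => h fun hy0 => hx (by simp [hy0])⟩
  refine hK.of_isClosed_subset ?_ h
  exact ((isLocallyConstant_unit d).isOpen_fiber 0).isClosed_compl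

lemma LPA.one_mul_one {L L' : Set (InfPath E)} (hc : IsCompact L) (ho : IsOpen L)
    (hc' : IsCompact L') (ho' : IsOpen L') :
    LPA.one R hc ho * LPA.one R hc' ho' =
      LPA.one R (hc.inter_right hc'.isClosed) (ho.inter ho') :=
  Subtype.ext ((conv_char_char (rInj_units _)).trans (by rw [mulSet_units]; rfl))

lemma LPA.one_mul_self {L : Set (InfPath E)} (hc : IsCompact L) (ho : IsOpen L) :
    LPA.one R hc ho * LPA.one R hc ho = LPA.one R hc ho :=
  Subtype.ext ((conv_char_char (rInj_units _)).trans (by rw [mulSet_units, Set.inter_self]; rfl))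

/-- Since the algebra need not have a unit, complements are taken relative to a compact open set. As
an identity in the ring it passes through π, and it makes the filter in `MapsDiagonal.exists_point`
an ultrafilter. -/
lemma LPA.one_eq_add_diff {L L' : Set (InfPath E)} (hc : IsCompact L) (ho : IsOpen L)
    (hc' : IsCompact L') (ho' : IsOpen L') :
    LPA.one R hc ho = LPA.one R hc ho * LPA.one R hc' ho' +
      LPA.one R (hc.diff ho') (ho.sdiff hc'.isClosed) := by
  refine diag_ext (LPA.one_mem_diag _ _) (add_mem (mul_mem_diag (LPA.one_mem_diag _ _)
    (LPA.one_mem_diag _ _)) (LPA.one_mem_diag _ _)) fun x => ?_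
  rw [LPA.one_mul_one]
  change _ = (LPA.one R _ _).1 (unit x) + (LPA.one R _ _).1 (unit x)
  rw [LPA.one_apply, LPA.one_apply, LPA.one_apply]
  by_cases h : x ∈ L <;> by_cases h' : x ∈ L' <;> simp [h, h']

/-- The idempotents of the diagonal are the characteristic functions of compact open sets. -/
lemma eq_one_of_idem (hE : E.RowFinite) {d : LPA R E} (hd : d ∈ diagonal R E)
    (h : d * d = d) :
    d = LPA.one R (isCompact_unitSupport hE hd) (isOpen_unitSupport d) := by
  refine diag_ext hd (LPA.one_mem_diag _ _) fun x => ?_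
  rw [LPA.one_apply]
  split_ifs with hx
  -- The value at `x` is a nonzero idempotent of `R`, hence 1 by cancellation in a domain.
  · have h1 := diag_mul_unit hd d x
    rw [h] at h1
    exact (mul_eq_left₀ hx).1 h1.symm
  · exact not_not.1 hx

end Support

/-! ### Stone duality: the homeomorphism κ -/

section Induced

variable {R : Type w} [CommRing R] [IsDomain R] [StarRing R]
  {E : DirectedGraph.{u₁, v₁}} {F : DirectedGraph.{u₂, v₂}}

/-- The isomorphism `π` maps `D(E)` into `D(F)`. -/
def MapsDiagonal (π : LPA R E ≃⋆+* LPA R F) : Prop :=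
  ∀ d ∈ diagonal R E, π d ∈ diagonal R F

variable {π : LPA R E ≃⋆+* LPA R F}

/-- The image of `1_L` is an idempotent of the diagonal of `F`. Multiplicativity suffices for this.
-/
lemma MapsDiagonal.map_one (hF : F.RowFinite) (hπ : MapsDiagonal π) {L : Set (InfPath E)}
    (hc : IsCompact L) (ho : IsOpen L) :
    π (LPA.one R hc ho) =
      LPA.one R (isCompact_unitSupport hF (hπ _ (LPA.one_mem_diag hc ho)))
        (isOpen_unitSupport (π (LPA.one R hc ho))) :=
  eq_one_of_idem hF (hπ _ (LPA.one_mem_diag hc ho)) (by rw [← map_mul, LPA.one_mul_self])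

/-- Every path `y` in `F` determines a path in `E`, the point of the ultrafilter of the compact
open sets `L` with `y ∈ supp(π(1_L))`. -/
lemma MapsDiagonal.exists_point (hE : E.RowFinite) (hF : F.RowFinite) (hπ : MapsDiagonal π)
    (hπ' : MapsDiagonal π.symm) (y : InfPath F) :
    ∃ x : InfPath E, ∀ (L : Set (InfPath E)) (hc : IsCompact L) (ho : IsOpen L),
      x ∈ L ↔ (π (LPA.one R hc ho)).1 (unit y) ≠ 0 := by
  -- Evaluation at `unit y` after π is multiplicative on characteristic functions; this gives the
  -- filter property.
  have hv : ∀ {L L' : Set (InfPath E)} (hc : IsCompact L) (ho : IsOpen L) (hc' : IsCompact L')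
      (ho' : IsOpen L'), (π (LPA.one R hc ho * LPA.one R hc' ho')).1 (unit y) =
        (π (LPA.one R hc ho)).1 (unit y) * (π (LPA.one R hc' ho')).1 (unit y) := by
    intro L L' hc ho hc' ho'
    rw [map_mul, diag_mul_unit (hπ _ (LPA.one_mem_diag hc ho))]
  -- The filter is nonempty: `L₀` is the support of the preimage under π of `1_K`, where `K` is the
  -- cylinder of the range vertex of `y`.
  obtain ⟨L₀, hc₀, ho₀, h₀⟩ : ∃ (L₀ : Set (InfPath E)) (hc : IsCompact L₀) (ho : IsOpen L₀),
      (π (LPA.one R hc ho)).1 (unit y) ≠ 0 := by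
    have h := LPA.one_mem_diag (R := R) (isCompact_cylinder hF (y.take 0)) (isOpen_cylinder _)
    refine ⟨_, isCompact_unitSupport hE (hπ' _ h), isOpen_unitSupport _, ?_⟩
    rw [← MapsDiagonal.map_one hE hπ', StarRingEquiv.apply_symm_apply, LPA.one_apply_ne]
    exact y.mem_cylinder_take 0
  let S := {L : Set (InfPath E) // ∃ (hc : IsCompact L) (ho : IsOpen L),
      (π (LPA.one R hc ho)).1 (unit y) ≠ 0}
  have : Nonempty S := ⟨⟨L₀, hc₀, ho₀, h₀⟩⟩
  -- Compactness yields a point common to all members, as they are nonempty and closed under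
  -- intersection.
  obtain ⟨x, hx⟩ : (⋂ L : S, L.1).Nonempty := by
    refine IsCompact.nonempty_iInter_of_directed_nonempty_isCompact_isClosed _ ?_ ?_
      (fun L => L.2.1) (fun L => L.2.1.isClosed)
    · rintro ⟨L, hc, ho, h⟩ ⟨L', hc', ho', h'⟩
      refine ⟨⟨L ∩ L', hc.inter_right hc'.isClosed, ho.inter ho', ?_⟩, Set.inter_subset_left,
        Set.inter_subset_right⟩
      rw [← LPA.one_mul_one hc ho hc' ho', hv]
      exact mul_ne_zero h h'
    · rintro ⟨L, hc, ho, h⟩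
      by_contra hL
      obtain rfl := Set.not_nonempty_iff_eq_empty.1 hL
      have : LPA.one R hc ho = 0 := Subtype.ext (by
        simp only [LPA.one, Set.image_empty, char_empty]
        rfl)
      exact h (by rw [this, map_zero]; rfl)
  rw [Set.mem_iInter] at hx
  refine ⟨x, fun L hc ho => ⟨fun hxL hy => ?_, fun h => hx ⟨L, hc, ho, h⟩⟩⟩
  -- If `L` were not in the filter, then `L₀ \ L` would be, and `x` would lie outside `L`.
  have h1 := LPA.one_eq_add_diff (R := R) hc₀ ho₀ hc ho
  have h2 : (π (LPA.one R hc₀ ho₀)).1 (unit y) =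
      (π (LPA.one R (hc₀.diff ho) (ho₀.sdiff hc.isClosed))).1 (unit y) := by
    conv_lhs => rw [h1, map_add]
    change (π (LPA.one R hc₀ ho₀ * LPA.one R hc ho)).1 (unit y) + _ = _
    rw [hv, hy, mul_zero, zero_add]
  rw [h2] at h₀
  exact (hx ⟨_, _, _, h₀⟩).2 hxL

/-- The preimage of a cylinder is the support of a locally constant function. -/
lemma continuous_of_forall_mem_iff (hE : E.RowFinite) {l : InfPath F → InfPath E}
    (hl : ∀ y (L : Set (InfPath E)) (hc : IsCompact L) (ho : IsOpen L),
      l y ∈ L ↔ (π (LPA.one R hc ho)).1 (unit y) ≠ 0) : Continuous l := by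
  refine continuous_generateFrom_iff.2 ?_
  rintro _ ⟨μ, rfl⟩
  have : l ⁻¹' μ.cylinder =
      unitSupport (π (LPA.one R (isCompact_cylinder hE μ) (isOpen_cylinder μ))) :=
    Set.ext fun y => hl y _ _ _
  rw [this]
  exact isOpen_unitSupport _

/-- If `x ∈ L`, put `K = supp(π(1_L))`. Then `π⁻¹(1_K) = 1_L` is nonzero at `x`, so `k x ∈ K`, that
is, `l (k x) ∈ L`. Compact open sets separate points. -/
lemma MapsDiagonal.leftInverse_of_forall_mem_iff (hE : E.RowFinite) (hF : F.RowFinite)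
    (hπ : MapsDiagonal π) {l : InfPath F → InfPath E} {k : InfPath E → InfPath F}
    (hl : ∀ y (L : Set (InfPath E)) (hc : IsCompact L) (ho : IsOpen L),
      l y ∈ L ↔ (π (LPA.one R hc ho)).1 (unit y) ≠ 0)
    (hk : ∀ x (K : Set (InfPath F)) (hc : IsCompact K) (ho : IsOpen K),
      k x ∈ K ↔ (π.symm (LPA.one R hc ho)).1 (unit x) ≠ 0) (x : InfPath E) : l (k x) = x := by
  refine InfPath.eq_of_compactOpen hE fun L hc ho h => (hl _ L hc ho).2 ?_
  refine (hk x _ (isCompact_unitSupport hF (hπ _ (LPA.one_mem_diag hc ho)))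
    (isOpen_unitSupport _)).2 ?_
  rwa [← hπ.map_one hF hc ho, StarRingEquiv.symm_apply_apply, LPA.one_apply_ne]

/-- Stone duality: `π` induces a homeomorphism of the infinite-path spaces. -/
lemma MapsDiagonal.exists_homeomorph (hE : E.RowFinite) (hF : F.RowFinite) (hπ : MapsDiagonal π)
    (hπ' : MapsDiagonal π.symm) :
    ∃ κ : InfPath E ≃ₜ InfPath F, IsInduced π κ ∧ IsInduced π.symm κ.symm ∧
      ∀ κ' : InfPath E → InfPath F, IsInduced π κ' → κ' = κ := by
  choose l hl using hπ.exists_point hE hF hπ'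
  choose k hk using hπ'.exists_point hF hE hπ
  have hlk := hπ.leftInverse_of_forall_mem_iff hE hF hl hk
  have hkl := hπ'.leftInverse_of_forall_mem_iff hF hE hk hl
  refine ⟨⟨⟨k, l, hlk, hkl⟩, ?_, ?_⟩, ?_, ?_, ?_⟩
  · exact continuous_of_forall_mem_iff hF hk
  · exact continuous_of_forall_mem_iff hE hl
  · intro L hc ho x
    have := hl (k x) L hc ho
    rwa [hlk] at this
  · intro L hc ho x
    have := hk (l x) L hc ho
    rwa [hkl] at this
  · intro κ' h
    funext x
    -- Any induced map is a section of `l`, which is already known to be bijective with inverse `k`.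
    have : l (κ' x) = x := InfPath.eq_of_compactOpen hE fun L hc ho hx =>
      (hl _ _ hc ho).2 ((h L hc ho x).1 hx)
    change κ' x = k x
    rw [← this, hkl, this]

end Induced

/-! ### Partial actions and degrees in terms of the diagonal -/

section Normalizers

variable {R : Type w} [CommRing R] [IsDomain R] [StarRing R] {E : DirectedGraph.{u, v}}

lemma star_mem_diag {d : LPA R E} (hd : d ∈ diagonal R E) : star d ∈ diagonal R E := by
  induction hd using Submodule.span_induction with
  | mem x h =>
    obtain ⟨μ, rfl⟩ := h
    have : star (LPA.char R μ μ) = LPA.char R μ μ := Subtype.ext (by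
      classical
      funext g
      simp only [coe_star, convStar, LPA.char, charFun, Set.indicator_apply, inv_mem_Z]
      split_ifs <;> simp)
    simp only [this]
    exact char_mem_diag μ
  | zero => rw [star_zero]; exact zero_mem _
  | add y z _ _ hy hz => rw [star_add]; exact add_mem hy hz
  | smul c y _ hy =>
    have : star (c • y) = star c • star y := Subtype.ext (by
      funext g
      simp [coe_star, convStar])
    rw [this]
    exact Submodule.smul_mem _ _ hy

lemma diag_mem_normalizers {d : LPA R E} (hd : d ∈ diagonal R E) : d ∈ normalizers R E :=
  fun _ hd' => ⟨mul_mem_diag (mul_mem_diag hd hd') (star_mem_diag hd),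
    mul_mem_diag (mul_mem_diag (star_mem_diag hd) hd') hd⟩

/-- The action `αₙ` in terms of the elements `n* 1_L n` of the diagonal. -/
lemma sandwich_ne_iff {n : LPA R E} (hn : n ∈ normalizers R E) {L : Set (InfPath E)}
    (hc : IsCompact L) (ho : IsOpen L) (x : InfPath E) :
    (star n * LPA.one R hc ho * n).1 (unit x) ≠ 0 ↔ x ∈ dom n ∧ alpha n x ∈ L := by
  have hL := LPA.one_mem_diag (R := R) hc ho
  constructor
  · intro h
    -- A nonzero value at `unit x` factors through some `ζ` in the support of `n` with source `x`;
    -- its range, which is `αₙ(x)`, is where `1_L` is evaluated.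
    obtain ⟨η, ζ, hh, h1, h2, h3⟩ := exists_of_conv_ne h
    rw [mul_diag_apply hL] at h2
    have h4 := (LPA.one_apply_ne hc ho).1 (right_ne_zero_of_mul h2)
    obtain rfl : x = ζ.source := congrArg GraphGroupoid.source h1
    exact ⟨(mem_dom hn).2 ⟨ζ, h3, rfl⟩, by rwa [alpha_eq hn h3, ← hh]⟩
  · rintro ⟨hx, hα⟩
    obtain ⟨g, hg, rfl⟩ := (mem_dom hn).1 hx
    rw [alpha_eq hn hg] at hα
    -- The unit is written as `g⁻¹g`. No cancellation can occur in the convolution because the left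
    -- factor `n* 1_L` is itself a normalizer.
    rw [← inv_comp_self]
    refine comp_ne (mul_mem_normalizers (star_mem_normalizers hn) (diag_mem_normalizers hL))
      ?_ hg rfl
    rw [mul_diag_apply hL]
    exact mul_ne_zero (inv_ne hg) ((LPA.one_apply_ne hc ho).2 hα)

/-- An element of `L_R(E)` that vanishes off the unit at an isolated path is in the diagonal. -/
lemma mem_diag_of_isolated {x : InfPath E} (hi : IsOpen {x}) {f : LPA R E}
    (hf : ∀ g, f.1 g ≠ 0 → g = unit x) : f ∈ diagonal R E := by
  have h : f = f.1 (unit x) • LPA.one R isCompact_singleton hi := by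
    refine Subtype.ext (funext fun g => ?_)
    change f.1 g = f.1 (unit x) * (LPA.one R isCompact_singleton hi).1 g
    by_cases hg : g = unit x
    · rw [hg, LPA.one_apply, if_pos (Set.mem_singleton x), mul_one]
    · have h1 : f.1 g = 0 := by_contra fun h => hg (hf g h)
      have h2 : (LPA.one R isCompact_singleton hi).1 g = 0 := by simp [LPA.one, charFun, hg]
      rw [h1, h2, mul_zero]
  rw [h]
  exact Submodule.smul_mem _ _ (LPA.one_mem_diag _ _)

/-- The function `pₓ` is in general only a function on the groupoid; isolation of `x` puts it in the
algebra, where π applies. -/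
lemma conv_pointFun_eq {x : InfPath E} (hi : IsOpen {x}) (f : LPA R E) :
    conv (conv (pointFun R x) f.1) (pointFun R x) =
      (LPA.one R isCompact_singleton hi * f * LPA.one R isCompact_singleton hi).1 := by
  simp only [coe_mul, LPA.one, Set.image_singleton, pointFun]

/-- At an isolated path `x`, the corner element `pₓ f pₓ` is homogeneous of degree `0` if and only if
it is in the diagonal. -/
lemma isHomogeneous_iff_mem_diag {x : InfPath E} (hi : IsOpen {x}) (f : LPA R E) :
    IsHomogeneous (conv (conv (pointFun R x) f.1) (pointFun R x)) 0 ↔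
      LPA.one R isCompact_singleton hi * f * LPA.one R isCompact_singleton hi ∈
        diagonal R E := by
  have hp := LPA.one_mem_diag (R := R) isCompact_singleton hi
  rw [conv_pointFun_eq hi]
  constructor
  · intro h
    refine mem_diag_of_isolated hi fun g hg => ?_
    have hl := h g hg
    rw [mul_diag_apply hp, diag_mul_apply hp] at hg
    have hr : g.range ∈ ({x} : Set (InfPath E)) :=
      (LPA.one_apply_ne _ _).1 (left_ne_zero_of_mul (left_ne_zero_of_mul hg))
    have hs : g.source ∈ ({x} : Set (InfPath E)) :=
      (LPA.one_apply_ne _ _).1 (right_ne_zero_of_mul hg)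
    -- The corner lives on the isotropy elements `(x, k, x)`, of which only the unit has degree 0.
    exact GraphGroupoid.ext hr hl hs
  · intro h g hg
    exact congrArg GraphGroupoid.lag (diag_unit h hg)

end Normalizers

/-! ### Transport of the Weyl groupoid along π and κ -/

section Transport

variable {R : Type w} [CommRing R] [IsDomain R] [StarRing R]
  {E : DirectedGraph.{u₁, v₁}} {F : DirectedGraph.{u₂, v₂}}

/-- The compatibilities of Ψ with the operations already hold for representatives, so they are
proved as equalities of pairs. -/
lemma WeylPair.ext_of_eq {p q : WeylPair R E} (hn : p.n = q.n) (hx : p.x = q.x) :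
    p = q := by
  cases p
  cases q
  subst hn
  subst hx
  rfl

/-- The isomorphism `π` preserves the diagonals and induces the homeomorphism `κ`. -/
structure IsDiagonalIso (π : LPA R E ≃⋆+* LPA R F) (κ : InfPath E ≃ₜ InfPath F) : Prop where
  rowFinite_left : E.RowFinite
  rowFinite_right : F.RowFinite
  maps : MapsDiagonal π
  maps_symm : MapsDiagonal π.symm
  induced : IsInduced π κ
  induced_symm : IsInduced π.symm κ.symm

namespace IsDiagonalIso

variable {π : LPA R E ≃⋆+* LPA R F} {κ : InfPath E ≃ₜ InfPath F}

/-- The data are symmetric by design: each one-sided statement about π also serves for its inverse.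
-/
lemma symm (h : IsDiagonalIso π κ) : IsDiagonalIso π.symm κ.symm :=
  ⟨h.rowFinite_right, h.rowFinite_left, h.maps_symm, h.maps, h.induced_symm, h.induced⟩

/-- Phrased with `K` on the side of `F`, so that points of the path space of `F` can be tested
against arbitrary compact open sets. -/
lemma map_one (h : IsDiagonalIso π κ) {K : Set (InfPath F)} (hc : IsCompact K) (ho : IsOpen K)
    (hc' : IsCompact (κ ⁻¹' K)) (ho' : IsOpen (κ ⁻¹' K)) :
    π (LPA.one R hc' ho') = LPA.one R hc ho := by
  have hK : unitSupport (π (LPA.one R hc' ho')) = K := by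
    ext y
    have := h.induced _ hc' ho' (κ.symm y)
    rw [Set.mem_preimage, κ.apply_symm_apply] at this
    exact this.symm
  rw [h.maps.map_one h.rowFinite_right]
  congr 1

/-- Vanishing at `x` is vanishing near `x`, hence a ring equation `d * 1_L = 0` with `x ∈ L`.
Applying π gives a product of two nonzero elements of a domain equal to 0. -/
lemma ne_of_map_ne (h : IsDiagonalIso π κ) {d : LPA R E} (hd : d ∈ diagonal R E) {x : InfPath E}
    (hx : (π d).1 (unit (κ x)) ≠ 0) : d.1 (unit x) ≠ 0 := by
  intro h0
  obtain ⟨k, hk⟩ := exists_take_subset ((isLocallyConstant_unit d).isOpen_fiber 0)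
    (show x ∈ {x | d.1 (unit x) = 0} from h0)
  have hc := isCompact_cylinder h.rowFinite_left (x.take k)
  have ho := isOpen_cylinder (x.take k)
  have hz : d * LPA.one R hc ho = 0 := by
    refine diag_ext (mul_mem_diag hd (LPA.one_mem_diag _ _)) (zero_mem _) fun y => ?_
    rw [diag_mul_unit hd, LPA.one_apply]
    split_ifs with hy
    · rw [show d.1 (unit y) = 0 from hk k le_rfl hy, zero_mul]
      rfl
    · rw [mul_zero]
      rfl
  have h1 := diag_mul_unit (h.maps d hd) (π (LPA.one R hc ho)) (κ x)
  rw [← map_mul, hz, map_zero] at h1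
  exact mul_ne_zero hx ((h.induced _ hc ho x).1 (x.mem_cylinder_take k)) h1.symm

lemma map_ne_iff (h : IsDiagonalIso π κ) {d : LPA R E} (hd : d ∈ diagonal R E) {x : InfPath E} :
    (π d).1 (unit (κ x)) ≠ 0 ↔ d.1 (unit x) ≠ 0 := by
  refine ⟨h.ne_of_map_ne hd, fun hx => h.symm.ne_of_map_ne (h.maps d hd) ?_⟩
  rwa [κ.symm_apply_apply, StarRingEquiv.symm_apply_apply]

lemma map_mem_normalizers (h : IsDiagonalIso π κ) {n : LPA R E} (hn : n ∈ normalizers R E) :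
    π n ∈ normalizers R F := by
  intro d hd
  have h1 := hn _ (h.maps_symm d hd)
  have h2 := h.maps _ h1.1
  have h3 := h.maps _ h1.2
  simp only [map_mul, map_star, StarRingEquiv.apply_symm_apply] at h2 h3
  exact ⟨h2, h3⟩

/-- The element `n* 1_{κ⁻¹(K)} n` is diagonal and π sends it to `π(n)* 1_K π(n)`. Comparing supports
shows that every compact open `K` containing `κ(αₙ(x))` also contains the image of `κ(x)` under the
action of `π(n)`. -/
lemma map_mem_dom (h : IsDiagonalIso π κ) {n : LPA R E} (hn : n ∈ normalizers R E)
    {x : InfPath E} (hx : x ∈ dom n) :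
    κ x ∈ dom (π n) ∧ alpha (π n) (κ x) = κ (alpha n x) := by
  have key : ∀ K : Set (InfPath F), IsCompact K → IsOpen K → κ (alpha n x) ∈ K →
      κ x ∈ dom (π n) ∧ alpha (π n) (κ x) ∈ K := by
    intro K hc ho hK
    have hc' : IsCompact (κ ⁻¹' K) := κ.isCompact_preimage.2 hc
    have ho' : IsOpen (κ ⁻¹' K) := ho.preimage κ.continuous
    have h1 := (sandwich_ne_iff hn hc' ho' x).2 ⟨hx, hK⟩
    have hd := (hn _ (LPA.one_mem_diag (R := R) hc' ho')).2
    have h2 := (h.map_ne_iff hd).2 h1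
    rw [map_mul, map_mul, map_star, h.map_one hc ho] at h2
    exact (sandwich_ne_iff (h.map_mem_normalizers hn) hc ho _).1 h2
  refine ⟨(key _ (isCompact_cylinder h.rowFinite_right _) (isOpen_cylinder _)
    (InfPath.mem_cylinder_take _ 0)).1, ?_⟩
  exact InfPath.eq_of_compactOpen h.rowFinite_right fun K hc ho hK => (key K hc ho hK).2

/-- The map `(n, x) ↦ (π(n), κ(x))`. -/
noncomputable def mapPair (h : IsDiagonalIso π κ) (p : WeylPair R E) : WeylPair R F :=
  ⟨π p.n, κ p.x, h.map_mem_normalizers p.n_mem, (h.map_mem_dom p.n_mem p.x_mem).1⟩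

lemma isIsolated_map (κ : InfPath E ≃ₜ InfPath F) {x : InfPath E} (hi : IsIsolated x) :
    IsIsolated (κ x) := by
  have := κ.isOpenMap _ hi
  rwa [Set.image_singleton] at this

lemma isIsolated_map_iff (κ : InfPath E ≃ₜ InfPath F) {x : InfPath E} :
    IsIsolated (κ x) ↔ IsIsolated x := by
  refine ⟨fun hi => ?_, isIsolated_map κ⟩
  have := isIsolated_map κ.symm hi
  rwa [κ.symm_apply_apply] at this

/-- The homeomorphism preserves isolation, so the two cases do not mix. Degree 0 is carried over as
membership in the diagonal, and agreement on `V` as agreement on `κ(V)`. -/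
lemma weylRel_mapPair (h : IsDiagonalIso π κ) {p q : WeylPair R E} (hpq : WeylRel p q) :
    WeylRel (h.mapPair p) (h.mapPair q) := by
  obtain ⟨hx, ⟨hi, hα, hh⟩ | ⟨hi, V, hV, hxV, hVd, hVα⟩⟩ := hpq
  · have hi' := isIsolated_map κ hi
    refine ⟨congrArg κ hx, Or.inl ⟨hi', ?_, ?_⟩⟩
    · change alpha (π p.n) (κ p.x) = alpha (π q.n) (κ p.x)
      rw [(h.map_mem_dom p.n_mem p.x_mem).2, (h.map_mem_dom q.n_mem (hx ▸ q.x_mem)).2, hα]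
    · refine (isHomogeneous_iff_mem_diag hi' _).2 ?_
      have h1 := h.maps _ ((isHomogeneous_iff_mem_diag hi _).1 hh)
      have hpre : κ ⁻¹' {κ p.x} = {p.x} := by
        ext y
        simp
      -- The map π sends `1_{x}` to `1_{κ(x)}`, so it carries corner to corner.
      have hone : π (LPA.one R isCompact_singleton hi) =
          LPA.one R isCompact_singleton hi' := by
        rw [← h.map_one isCompact_singleton hi' (by rw [hpre]; exact isCompact_singleton)
          (by rw [hpre]; exact hi)]
        congr 2
        exact hpre.symm
      rw [map_mul, map_mul, hone, map_mul, map_star] at h1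
      exact h1
  · refine ⟨congrArg κ hx, Or.inr ⟨fun hc => hi ((isIsolated_map_iff κ).1 hc), κ '' V,
      κ.isOpenMap _ hV, ⟨_, hxV, rfl⟩, ?_, ?_⟩⟩
    · rintro _ ⟨y, hy, rfl⟩
      exact ⟨(h.map_mem_dom p.n_mem (hVd hy).1).1, (h.map_mem_dom q.n_mem (hVd hy).2).1⟩
    · rintro _ ⟨y, hy, rfl⟩
      change alpha (π p.n) (κ y) = alpha (π q.n) (κ y)
      rw [(h.map_mem_dom p.n_mem (hVd hy).1).2, (h.map_mem_dom q.n_mem (hVd hy).2).2, hVα y hy]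

/-- The map `[(n, x)] ↦ [(π(n), κ(x))]`. -/
noncomputable def map (h : IsDiagonalIso π κ) : WeylGroupoid R E → WeylGroupoid R F :=
  Quotient.map h.mapPair fun _ _ hpq => h.weylRel_mapPair hpq

lemma map_symm_map (h : IsDiagonalIso π κ) (a : WeylGroupoid R E) : h.symm.map (h.map a) = a := by
  obtain ⟨p⟩ := a
  exact congrArg WeylGroupoid.ofPair
    (WeylPair.ext_of_eq (StarRingEquiv.symm_apply_apply π p.n) (κ.symm_apply_apply p.x))

lemma alpha_mapPair (h : IsDiagonalIso π κ) {p q : WeylPair R E} (hpq : alpha q.n q.x = p.x) :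
    alpha (h.mapPair q).n (h.mapPair q).x = (h.mapPair p).x :=
  (h.map_mem_dom q.n_mem q.x_mem).2.trans (congrArg κ hpq)

lemma mapPair_mul (h : IsDiagonalIso π κ) (p q : WeylPair R E) (hpq : alpha q.n q.x = p.x) :
    h.mapPair (p.mul q hpq) = (h.mapPair p).mul (h.mapPair q) (h.alpha_mapPair hpq) :=
  WeylPair.ext_of_eq (map_mul π p.n q.n) rfl

/-- Basic sets pull back to basic sets: the preimage of `Z(m)` is `Z(π⁻¹(m))`. -/
lemma continuous_map (h : IsDiagonalIso π κ) : Continuous h.map := by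
  refine continuous_generateFrom_iff.2 ?_
  rintro _ ⟨m, hm, rfl⟩
  have hm' := h.symm.map_mem_normalizers hm
  have : h.map ⁻¹' WeylGroupoid.basicSet m hm = WeylGroupoid.basicSet (π.symm m) hm' := by
    ext a
    constructor
    · rintro ⟨y, hy, ha⟩
      refine ⟨κ.symm y, (h.symm.map_mem_dom hm hy).1, ?_⟩
      rw [← h.map_symm_map a, ha]
      rfl
    · rintro ⟨x, hx, rfl⟩
      have h1 := (h.map_mem_dom hm' hx).1
      rw [StarRingEquiv.apply_symm_apply] at h1
      exact ⟨κ x, h1, congrArg WeylGroupoid.ofPair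
        (WeylPair.ext_of_eq (StarRingEquiv.apply_symm_apply π m) rfl)⟩
  rw [this]
  exact TopologicalSpace.isOpen_generateFrom_of_mem ⟨_, hm', rfl⟩

/-- The isomorphism of the Weyl groupoids. -/
noncomputable def weylIso (h : IsDiagonalIso π κ) : TopGroupoidIso (WeylGroupoid R E) (WeylGroupoid R F) where
  toFun := h.map
  invFun := h.symm.map
  left_inv := h.map_symm_map
  -- `π.symm.symm` and `κ.symm.symm` unfold to π and κ.
  right_inv := h.symm.map_symm_map
  continuous_toFun := h.continuous_map
  continuous_invFun := h.symm.continuous_map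
  map_range := by
    rintro ⟨p⟩
    -- The range is the class of the product of a pair with its inverse; it remains to compare
    -- `π(n*)` with `π(n)*` and the base points.
    refine congrArg WeylGroupoid.ofPair ((h.mapPair_mul p p.inv p.alpha_inv).trans ?_)
    exact WeylPair.ext_of_eq (congrArg (π p.n * ·) (map_star π p.n))
      (h.map_mem_dom p.n_mem p.x_mem).2.symm
  map_source := by
    rintro ⟨p⟩
    refine congrArg WeylGroupoid.ofPair ((h.mapPair_mul p.inv p rfl).trans ?_)
    exact WeylPair.ext_of_eq (congrArg (· * π p.n) (map_star π p.n)) rfl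
  map_comp := by
    rintro ⟨p⟩ ⟨q⟩ hpq
    -- The product is defined through chosen representatives; `comp_ofPair` replaces them by the
    -- given ones on both sides.
    have h1 := WeylGroupoid.comp_ofPair p q hpq
    refine (congrArg h.map h1).trans (Eq.trans ?_
      (WeylGroupoid.comp_ofPair (h.mapPair p) (h.mapPair q) _).symm)
    exact congrArg WeylGroupoid.ofPair (h.mapPair_mul p q _)

end IsDiagonalIso

end Transport

end DirectedGraph

/-! ### The main theorem -/

theorem mainTheorem3 {R : Type w} [CommRing R] [IsDomain R] [StarRing R]
    (E : DirectedGraph.{u₁, v₁}) (F : DirectedGraph.{u₂, v₂})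
    (hE : E.RowFinite) (hE' : E.NoSources) (hF : F.RowFinite) (hF' : F.NoSources)
    (π : DirectedGraph.LPA R E ≃⋆+* DirectedGraph.LPA R F)
    (hπ : π '' (DirectedGraph.diagonal R E : Set (DirectedGraph.LPA R E)) =
      (DirectedGraph.diagonal R F : Set (DirectedGraph.LPA R F))) :
    ∃ κ : DirectedGraph.InfPath E ≃ₜ DirectedGraph.InfPath F,
      DirectedGraph.IsInduced π κ ∧
      (∀ κ' : DirectedGraph.InfPath E → DirectedGraph.InfPath F,
        DirectedGraph.IsInduced π κ' → κ' = κ) ∧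
      ∃ (hN : ∀ n ∈ DirectedGraph.normalizers R E, π n ∈ DirectedGraph.normalizers R F)
        (hdom : ∀ n ∈ DirectedGraph.normalizers R E, ∀ x ∈ DirectedGraph.dom n,
          κ x ∈ DirectedGraph.dom (π n))
        (Ψ : DirectedGraph.TopGroupoidIso (DirectedGraph.WeylGroupoid R E)
          (DirectedGraph.WeylGroupoid R F)),
        ∀ (n : DirectedGraph.LPA R E) (x : DirectedGraph.InfPath E)
          (hn : n ∈ DirectedGraph.normalizers R E) (hx : x ∈ DirectedGraph.dom n),
          Ψ.toHomeomorph (DirectedGraph.WeylGroupoid.mk n x hn hx) =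
            DirectedGraph.WeylGroupoid.mk (π n) (κ x) (hN n hn) (hdom n hn x hx) := by
  have h1 : DirectedGraph.MapsDiagonal π := fun d hd => by
    have : π d ∈ π '' (DirectedGraph.diagonal R E : Set (DirectedGraph.LPA R E)) := ⟨d, hd, rfl⟩
    rwa [hπ] at this
  -- The equality of diagonals is used as two inclusions, one for π and one for its inverse.
  have h2 : DirectedGraph.MapsDiagonal π.symm := fun d hd => by
    have : d ∈ (DirectedGraph.diagonal R F : Set (DirectedGraph.LPA R F)) := hd
    rw [← hπ] at this
    obtain ⟨d', hd', rfl⟩ := this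
    rwa [StarRingEquiv.symm_apply_apply]
  obtain ⟨κ, hκ, hκ', huniq⟩ := h1.exists_homeomorph hE hF h2
  have h : DirectedGraph.IsDiagonalIso π κ := ⟨hE, hF, h1, h2, hκ, hκ'⟩
  exact ⟨κ, hκ, huniq, fun _ hn => h.map_mem_normalizers hn,
    fun _ hn _ hx => (h.map_mem_dom hn hx).1, h.weylIso, fun _ _ _ _ => rfl⟩
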